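/- Let $n\ge 0$ and $r\ge 1$ be integers, let $\alpha\in\mathbb{R}$, and let $A\in M_n(\mathbb{C})$ be a positive semidefinite contraction, that is, a positive semidefinite Hermitian matrix whose Euclidean operator norm satisfies $\|A\|\le 1$. Suppose that every diagonal entry of $A$ is at most $\alpha$. Then $A$ has an $r$-paving with largest eigenvalue at most $4r^{-1/4}+\alpha$: there are pairwise disjoint (possibly empty) sets $S_1,\dots,S_r$ with $S_1\cup\dots\cup S_r=\{1,\dots,n\}$ such that for every $j\in\{1,\dots,r\}$ every eigenvalue of the principal submatrix $A(S_j)=(A_{kl})_{k,l\in S_j}$ is at most $$\frac{4}{r^{1/4}}+\alpha .$$ (An empty block has no eigenvalues.) -/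

import Mathlib

open scoped ComplexOrder

/-- An `r`-paving of an index set `ι`: a family of `r` pairwise disjoint subsets with union `ι`.
Blocks may be empty (they have to be when `r` exceeds the size of `ι`). -/
structure Paving (ι : Type*) [Fintype ι] [DecidableEq ι] (r : ℕ) where
  block : Fin r → Finset ι
  disjoint : ∀ j k, j ≠ k → Disjoint (block j) (block k)
  cover : ∀ i, ∃ j, i ∈ block j

/-- The principal submatrix `A(S)` with rows and columns indexed by `S`. -/
def principalBlock {ι : Type*} (A : Matrix ι ι ℂ) (S : Finset ι) : Matrix S S ℂ :=
  A.submatrix Subtype.val Subtype.val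

/-- A positive semidefinite (in particular Hermitian) matrix whose operator norm with respect to
the Euclidean norm on `ℂ^ι` is at most `1`. -/
def IsPSDContraction {ι : Type*} [Fintype ι] [DecidableEq ι] (A : Matrix ι ι ℂ) : Prop :=
  A.PosSemidef ∧ ‖Matrix.toEuclideanCLM (𝕜 := ℂ) A‖ ≤ 1

/-! ### Families of blocks and the commutation of deletions. -/

section Families

variable {ι κ : Type*} [DecidableEq ι] [DecidableEq κ]

/-! The proof averages over all `r`-pavings. The sum over all pavings of the products of the
characteristic polynomials of the blocks is `mixedDet` for a list of all points and a family of full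
blocks. Two facts suffice: some paving has a product whose largest root is no larger than that of
the sum, and the largest root of the sum is below `4 * r ^ (-1/4) + α`.

Both rest on stability. With a separate variable for each pair (colour, point), the mixed
determinant is affine in each variable (`mixedDet_updateAt`), its derivative being the mixed
determinant with that point deleted from that block, and it has no zero when all variables lie in
the upper half plane (`mixedDet_ne_zero`). Hence polynomial over derivative maps the upper half
plane to its closure; `im_mixedDet_mul_conj` states this without division and allows real variables.

For the selection, the colours of one point give summands `f j` with the same derivative `d`. Each
`f j / d` increases where `d` is positive, so a summand that is positive at `ρ` stays positive
beyond it (`exists_keepOnly_pos`). Colouring the points one by one gives `exists_family_pos`.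

For the root bound, the variables of one point are identified across colours. The sum over its
colours is then the effect of `polarPart`, which turns `c ∏ (X - a j)` into `c ∑ (X - a j)`
(`polarPart_slice`); so the average arises from `det (Z - A) ^ r` by one such operation per point.
When all variables are at least `t > 1`, the logarithmic derivatives of `det (Z - A)` are at most `φ
= 1 / t + α / (t * (t - 1))` (`principalDet_erase_le`). This bounds the reciprocals of the gaps to
the roots in one variable, and Cauchy-Schwarz makes the gaps large enough to lower that variable by
`δ` when its operation is applied. The other logarithmic derivatives stay below `φ` by a partial
fraction expansion with nonnegative coefficients (`exists_partialFractions`, `polarPart_barrier`).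
Each variable is lowered once, so all reach `t - δ` (`mixedRe_barrier`), and `sub_shift_le`
evaluates this for a suitable `t`. -/

/-- Remove `k` from all members of the family `B` except for the one with index `j`. -/
def keepOnly (B : κ → Finset ι) (k : ι) (j : κ) : κ → Finset ι :=
  fun l => if l = j then B l else (B l).erase k

/-- Remove `m` from the member of the family `B` with index `l`. -/
def dropAt (B : κ → Finset ι) (l : κ) (m : ι) : κ → Finset ι :=
  Function.update B l ((B l).erase m)

/-- Remove `k` from all members of the family `B`. -/
def dropAll (B : κ → Finset ι) (k : ι) : κ → Finset ι :=
  fun l => (B l).erase k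

theorem keepOnly_dropAt_comm (B : κ → Finset ι) (k : ι) (j l : κ) (m : ι) :
    keepOnly (dropAt B l m) k j = dropAt (keepOnly B k j) l m := by
  ext i x
  by_cases h : i = l
  · subst h; by_cases h' : i = j <;> (simp [keepOnly, dropAt, h']; try tauto)
  · simp [keepOnly, dropAt, h]

theorem keepOnly_dropAll_comm (B : κ → Finset ι) (k : ι) (j : κ) (m : ι) :
    keepOnly (dropAll B m) k j = dropAll (keepOnly B k j) m := by
  ext i x
  by_cases h' : i = j <;> (simp [keepOnly, dropAll, h']; try tauto)

theorem keepOnly_comm (B : κ → Finset ι) (k m : ι) (i j : κ) :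
    keepOnly (keepOnly B k i) m j = keepOnly (keepOnly B m j) k i := by
  ext l x
  by_cases h : l = i <;> by_cases h' : l = j <;> simp [keepOnly, h, h']
  tauto

/-- The result does not depend on `j`: all colour choices for `k` share one derivative. Interlacing
and stability of the sum both depend on this common denominator. -/
theorem dropAt_keepOnly_self (B : κ → Finset ι) (k : ι) (j : κ) :
    dropAt (keepOnly B k j) j k = dropAll B k := by
  ext l x
  by_cases h' : l = j
  · subst h'; simp [keepOnly, dropAll, dropAt]
  · simp [keepOnly, dropAll, dropAt, h']

theorem mem_keepOnly {B : κ → Finset ι} {k v : ι} {j l : κ} (h : v ∈ B l) (hv : v ≠ k) :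
    v ∈ keepOnly B k j l := by
  unfold keepOnly; split_ifs <;> simp [h, hv]

theorem mem_keepOnly_self {B : κ → Finset ι} {k : ι} {j : κ} (h : k ∈ B j) :
    k ∈ keepOnly B k j j := by
  simp [keepOnly, h]

theorem mem_dropAt {B : κ → Finset ι} {m v : ι} {j l : κ} (h : v ∈ B l) (hv : v ≠ m) :
    v ∈ dropAt B j m l := by
  unfold dropAt
  by_cases h' : l = j
  · subst h'; simp [h, hv]
  · simp [h', h]

omit [DecidableEq κ] in
theorem mem_dropAll {B : κ → Finset ι} {m v : ι} {l : κ} (h : v ∈ B l) (hv : v ≠ m) :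
    v ∈ dropAll B m l := by
  simp [dropAll, h, hv]

end Families

/-! ### Principal and mixed determinants, affine in each variable. -/

section Algebra

variable {ι κ R S : Type*} [Fintype ι] [DecidableEq ι] [Fintype κ] [DecidableEq κ]
  [CommRing R] [Algebra ℂ R] [CommRing S] [Algebra ℂ S]

/-- The matrix that agrees with `diag z - A` on `B × B` and with the identity elsewhere. -/
def maskedMatrix (A : Matrix ι ι ℂ) (B : Finset ι) (z : ι → R) : Matrix ι ι R :=
  Matrix.of fun i j =>
    if i ∈ B ∧ j ∈ B then (if i = j then z i else 0) - algebraMap ℂ R (A i j)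
    else if i = j then 1 else 0

/-- The determinant of the principal block of `diag z - A` on `B`. -/
def principalDet (A : Matrix ι ι ℂ) (B : Finset ι) (z : ι → R) : R :=
  (maskedMatrix A B z).det

/-- The sum, over all ways to keep each element of `V` in exactly one member of the family `B`,
of the products of the principal determinants. -/
def mixedDet (A : Matrix ι ι ℂ) : List ι → (κ → Finset ι) → (κ → ι → R) → R
  | [], B, z => ∏ l, principalDet A (B l) (z l)
  | k :: V, B, z => ∑ j, mixedDet A V (keepOnly B k j) z

theorem map_principalDet (f : R →ₐ[ℂ] S) (A : Matrix ι ι ℂ) (B : Finset ι) (z : ι → R) :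
    f (principalDet A B z) = principalDet A B (fun i => f (z i)) := by
  unfold principalDet
  rw [AlgHom.map_det]
  congr 1
  ext i j
  simp only [maskedMatrix, AlgHom.mapMatrix_apply, Matrix.map_apply, Matrix.of_apply]
  split_ifs <;> simp

theorem map_mixedDet (f : R →ₐ[ℂ] S) (A : Matrix ι ι ℂ) (V : List ι) (B : κ → Finset ι)
    (z : κ → ι → R) :
    f (mixedDet A V B z) = mixedDet A V B (fun l i => f (z l i)) := by
  induction V generalizing B with
  | nil => simp [mixedDet, map_principalDet]
  | cons k V ih => simp [mixedDet, ih]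

theorem principalDet_congr (A : Matrix ι ι ℂ) (B : Finset ι) {z w : ι → R}
    (h : ∀ i ∈ B, z i = w i) : principalDet A B z = principalDet A B w := by
  unfold principalDet
  congr 1
  ext i j
  simp only [maskedMatrix, Matrix.of_apply]
  split_ifs with h1 h2 <;> simp [h1, h]

omit [Algebra ℂ R] in
-- Both sides are the `(k, k)` cofactor, computed once by replacing a row and once by replacing a
-- column.
theorem det_updateRow_single_self (M : Matrix ι ι R) (k : ι) :
    (M.updateRow k (Pi.single k 1)).det =
      ((M.updateRow k (Pi.single k 1)).updateCol k (Pi.single k 1)).det := by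
  set N := M.updateRow k (Pi.single k 1)
  have h1 : N.updateRow k (Pi.single k 1) = N := by simp [N]
  have h2 : N.adjugate k k = N.det := by rw [Matrix.adjugate_apply, h1]
  have h3 : N.adjugate k k = (N.updateCol k (Pi.single k 1)).det := by
    have h4 := congrFun (congrFun (Matrix.adjugate_transpose N) k) k
    rw [Matrix.transpose_apply] at h4
    rw [h4, Matrix.adjugate_apply, ← Matrix.det_transpose, Matrix.updateRow_transpose,
      Matrix.transpose_transpose]
  rw [← h2, h3]

theorem det_maskedMatrix_updateRow (A : Matrix ι ι ℂ) (B : Finset ι) (m : ι) (z : ι → R) :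
    ((maskedMatrix A B z).updateRow m (Pi.single m 1)).det = principalDet A (B.erase m) z := by
  rw [det_updateRow_single_self, principalDet]
  congr 1
  ext i j
  by_cases hi : i = m
  · subst hi
    by_cases hj : j = i
    · subst hj; simp [maskedMatrix]
    · simp [maskedMatrix, hj, Ne.symm hj]
  · by_cases hj : j = m
    · subst hj; simp [maskedMatrix, hi]
    · simp [maskedMatrix, hi, hj]

theorem principalDet_update (A : Matrix ι ι ℂ) {B : Finset ι} {k : ι} (hk : k ∈ B)
    (z : ι → R) (w : R) :
    principalDet A B (Function.update z k w) =
      w * principalDet A (B.erase k) z + principalDet A B (Function.update z k 0) := by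
  unfold principalDet
  set M0 := maskedMatrix A B (Function.update z k 0)
  have h1 : maskedMatrix A B (Function.update z k w) =
      M0.updateRow k (w • Pi.single k 1 + M0 k) := by
    ext i j
    by_cases hi : i = k
    · subst hi
      by_cases hj : i = j
      · subst hj; simp [M0, maskedMatrix, hk]; ring
      · simp [M0, maskedMatrix, hk, hj, Ne.symm hj]
    · simp [M0, maskedMatrix, hi, Function.update_of_ne]
  have h2 : (M0.updateRow k (Pi.single k 1)).det = principalDet A (B.erase k) z := by
    rw [det_maskedMatrix_updateRow]
    exact principalDet_congr A _ fun i hi => by simp [Finset.ne_of_mem_erase hi]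
  rw [h1, Matrix.det_updateRow_add, Matrix.det_updateRow_smul, Matrix.updateRow_eq_self, h2]
  rfl

/-- Replace the entry `z l m` by `w`. -/
def updateAt (z : κ → ι → R) (l : κ) (m : ι) (w : R) : κ → ι → R :=
  Function.update z l (Function.update (z l) m w)

omit [Fintype ι] [Fintype κ] [CommRing R] [Algebra ℂ R] in
theorem updateAt_eq_self (z : κ → ι → R) (l : κ) (m : ι) : updateAt z l m (z l m) = z := by
  simp [updateAt]

/-- Only the factor of colour `l` involves this variable, and it is affine there. Since `m ∉ V`,
deleting `m` commutes with the colour choices, so `dropAt` acts as the partial derivative in `z l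
m`. -/
theorem mixedDet_updateAt (A : Matrix ι ι ℂ) {V : List ι} {B : κ → Finset ι} {l : κ} {m : ι}
    (hm : m ∈ B l) (hV : m ∉ V) (z : κ → ι → R) (w : R) :
    mixedDet A V B (updateAt z l m w) =
      w * mixedDet A V (dropAt B l m) z + mixedDet A V B (updateAt z l m 0) := by
  induction V generalizing B with
  | nil =>
    simp only [mixedDet]
    rw [← Finset.mul_prod_erase _ _ (Finset.mem_univ l),
      ← Finset.mul_prod_erase Finset.univ (fun x => principalDet A (B x) (updateAt z l m 0 x))
        (Finset.mem_univ l),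
      ← Finset.mul_prod_erase Finset.univ (fun x => principalDet A (dropAt B l m x) (z x))
        (Finset.mem_univ l)]
    have e1 : ∀ w' : R, ∏ x ∈ Finset.univ.erase l, principalDet A (B x) (updateAt z l m w' x) =
        ∏ x ∈ Finset.univ.erase l, principalDet A (B x) (z x) := by
      intro w'
      refine Finset.prod_congr rfl fun x hx => ?_
      rw [updateAt, Function.update_of_ne (Finset.ne_of_mem_erase hx)]
    have e2 : ∏ x ∈ Finset.univ.erase l, principalDet A (dropAt B l m x) (z x) =
        ∏ x ∈ Finset.univ.erase l, principalDet A (B x) (z x) := by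
      refine Finset.prod_congr rfl fun x hx => ?_
      rw [dropAt, Function.update_of_ne (Finset.ne_of_mem_erase hx)]
    rw [e1, e1, e2]
    simp only [updateAt, dropAt, Function.update_self]
    rw [principalDet_update A hm]
    ring
  | cons k V ih =>
    simp only [List.mem_cons, not_or] at hV
    simp only [mixedDet, Finset.mul_sum, ← Finset.sum_add_distrib]
    refine Finset.sum_congr rfl fun j _ => ?_
    rw [ih (mem_keepOnly hm hV.1) hV.2, keepOnly_dropAt_comm]

end Algebra

/-! ### Stability of mixed determinants. -/

section Stability

open Complex ComplexConjugate

variable {ι κ : Type*} [Fintype ι] [DecidableEq ι] [Fintype κ] [DecidableEq κ]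

/-- A kernel vector `v` vanishes off `B` and satisfies `∑ z i |v i|² = ⟨v, A v⟩`. The right side is
real, while the left has positive imaginary part unless `v = 0`. -/
theorem principalDet_ne_zero {A : Matrix ι ι ℂ} (hA : A.IsHermitian) (B : Finset ι) {z : ι → ℂ}
    (hz : ∀ i, 0 < (z i).im) : principalDet A B z ≠ 0 := by
  intro h0
  obtain ⟨v, hv, hMv⟩ := Matrix.exists_mulVec_eq_zero_iff.mpr h0
  have hrow : ∀ i, ∑ j, maskedMatrix A B z i j * v j = 0 := fun i => congrFun hMv i
  have hout : ∀ i ∉ B, v i = 0 := by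
    intro i hi
    have := hrow i
    simpa [maskedMatrix, hi] using this
  have hin : ∀ i ∈ B, z i * v i = ∑ j, A i j * v j := by
    intro i hi
    have h1 : ∀ j, maskedMatrix A B z i j * v j =
        (if i = j then z i * v i else 0) - A i j * v j := by
      intro j
      by_cases hj : j ∈ B
      · by_cases hij : i = j
        · subst hij; simp [maskedMatrix, hi, sub_mul]
        · simp [maskedMatrix, hi, hj, hij]
      · have : i ≠ j := fun h => hj (h ▸ hi)
        simp [hout j hj, this]
    have := hrow i
    simp only [h1, Finset.sum_sub_distrib] at this
    simpa [sub_eq_zero] using this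
  have hquad : ∑ i, z i * (normSq (v i) : ℂ) = star v ⬝ᵥ A.mulVec v := by
    simp only [dotProduct, Matrix.mulVec]
    refine Finset.sum_congr rfl fun i _ => ?_
    by_cases hi : i ∈ B
    · rw [← hin i hi, Complex.normSq_eq_conj_mul_self]; simp; ring
    · simp [hout i hi]
  have him : (star v ⬝ᵥ A.mulVec v).im = 0 := by
    have := hA.im_star_dotProduct_mulVec_self v
    simpa using this
  rw [← hquad, im_sum] at him
  simp only [im_mul_ofReal] at him
  apply hv
  ext i
  have := (Finset.sum_eq_zero_iff_of_nonneg
    (fun i _ => mul_nonneg (hz i).le (normSq_nonneg (v i)))).mp him i (Finset.mem_univ i)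
  simpa [(hz i).ne'] using this

/-- The root `-E / D` has nonpositive imaginary part, and `(w * D + E) / D` is `w` minus that root.
-/
theorem im_mul_conj_of_affine_ne_zero {D E w : ℂ} (hD : D ≠ 0)
    (h : ∀ w : ℂ, 0 < w.im → w * D + E ≠ 0) :
    w.im * normSq D ≤ ((w * D + E) * conj D).im := by
  have h1 : (-E / D).im ≤ 0 := by
    by_contra! hlt
    exact h _ hlt (by field_simp; ring)
  have h2 : -E * conj D = (-E / D) * (normSq D : ℂ) := by
    rw [← mul_conj]; field_simp
  have h3 : (w * D + E) * conj D = w * (normSq D : ℂ) - -E * conj D := by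
    rw [← mul_conj]; ring
  rw [h3, h2, sub_im, im_mul_ofReal, im_mul_ofReal]
  nlinarith [normSq_nonneg D]

theorem im_mixedDet_mul_conj_of_ne_zero (A : Matrix ι ι ℂ) {V : List ι}
    {B : κ → Finset ι} {l : κ} {m : ι} (hm : m ∈ B l) (hmV : m ∉ V) {z : κ → ι → ℂ}
    (hz : ∀ l i, 0 < (z l i).im) (hD : mixedDet A V (dropAt B l m) z ≠ 0)
    (h : ∀ z : κ → ι → ℂ, (∀ l i, 0 < (z l i).im) → mixedDet A V B z ≠ 0) :
    (z l m).im * normSq (mixedDet A V (dropAt B l m) z) ≤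
      (mixedDet A V B z * conj (mixedDet A V (dropAt B l m) z)).im := by
  have e := fun w => mixedDet_updateAt A hm hmV z w
  have e1 := e (z l m)
  rw [updateAt_eq_self] at e1
  rw [e1]
  refine im_mul_conj_of_affine_ne_zero hD fun w hw => ?_
  rw [← e w]
  refine h _ fun l' i => ?_
  unfold updateAt
  by_cases h1 : l' = l
  · subst h1
    by_cases h2 : i = m
    · subst h2; simpa using hw
    · simpa [h2] using hz l' i
  · simpa [h1] using hz l' i

theorem mixedDet_ne_zero [Nonempty κ] {A : Matrix ι ι ℂ} (hA : A.IsHermitian) {V : List ι}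
    (hV : V.Nodup) {B : κ → Finset ι} (hVB : ∀ v ∈ V, ∀ l, v ∈ B l) {z : κ → ι → ℂ}
    (hz : ∀ l i, 0 < (z l i).im) : mixedDet A V B z ≠ 0 := by
  induction V generalizing B z with
  | nil => exact Finset.prod_ne_zero_iff.mpr fun l _ => principalDet_ne_zero hA _ (hz l)
  | cons k V ih =>
    obtain ⟨hkV, hV⟩ := List.nodup_cons.mp hV
    have hne : ∀ v ∈ V, v ≠ k := fun v hv h => hkV (h ▸ hv)
    have hmem : ∀ v ∈ V, ∀ l, v ∈ B l := fun v hv => hVB v (List.mem_cons_of_mem _ hv)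
    have hD : mixedDet A V (dropAll B k) z ≠ 0 :=
      ih hV (fun v hv l => mem_dropAll (hmem v hv l) (hne v hv)) hz
    -- Divided by the common derivative, every summand lies in the open upper half plane, so the sum
    -- cannot vanish.
    have hpos : ∀ j, 0 < (mixedDet A V (keepOnly B k j) z *
        conj (mixedDet A V (dropAll B k) z)).im := by
      intro j
      have := im_mixedDet_mul_conj_of_ne_zero A
        (mem_keepOnly_self (j := j) (hVB k List.mem_cons_self j)) hkV hz
        (by rwa [dropAt_keepOnly_self])
        (fun z hz => ih hV (fun v hv l => mem_keepOnly (hmem v hv l) (hne v hv)) hz)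
      rw [dropAt_keepOnly_self] at this
      exact lt_of_lt_of_le (mul_pos (hz j k) (normSq_pos.mpr hD)) this
    intro h0
    have hsum : (mixedDet A (k :: V) B z * conj (mixedDet A V (dropAll B k) z)).im =
        ∑ j, (mixedDet A V (keepOnly B k j) z * conj (mixedDet A V (dropAll B k) z)).im := by
      rw [mixedDet, Finset.sum_mul, im_sum]
    rw [h0, zero_mul, zero_im] at hsum
    exact absurd hsum (Finset.sum_pos (fun j _ => hpos j) Finset.univ_nonempty).ne

theorem continuous_principalDet (A : Matrix ι ι ℂ) (B : Finset ι) :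
    Continuous fun z : ι → ℂ => principalDet A B z := by
  unfold principalDet maskedMatrix
  refine Continuous.matrix_det (continuous_matrix fun i j => ?_)
  simp only [Matrix.of_apply]
  split_ifs <;> fun_prop

theorem continuous_mixedDet (A : Matrix ι ι ℂ) (V : List ι) (B : κ → Finset ι) :
    Continuous fun z : κ → ι → ℂ => mixedDet A V B z := by
  induction V generalizing B with
  | nil =>
    exact continuous_finsetProd _ fun l _ =>
      (continuous_principalDet A (B l)).comp (continuous_apply l)
  | cons k V ih => exact continuous_finsetSum _ fun j _ => ih _

theorem im_mixedDet_mul_conj [Nonempty κ] {A : Matrix ι ι ℂ} (hA : A.IsHermitian) {V : List ι}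
    (hV : V.Nodup) {B : κ → Finset ι} (hVB : ∀ v ∈ V, ∀ l, v ∈ B l) {l : κ} {m : ι}
    (hm : m ∈ B l) (hmV : m ∉ V) {z : κ → ι → ℂ} (hz : ∀ l i, 0 ≤ (z l i).im) :
    (z l m).im * normSq (mixedDet A V (dropAt B l m) z) ≤
      (mixedDet A V B z * conj (mixedDet A V (dropAt B l m) z)).im := by
  -- Moving every variable up by `ε * I` reaches the region without zeros; the inequality survives
  -- `ε → 0`, although the nonvanishing may not.
  let s : ℝ → κ → ι → ℂ := fun ε l i => z l i + ε * I
  have hs : Continuous s := by fun_prop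
  have hs0 : s 0 = z := by ext; simp [s]
  have hc := (continuous_mixedDet A V B).comp hs
  have hd := (continuous_mixedDet A V (dropAt B l m)).comp hs
  have hw : Continuous fun ε => s ε l m := by fun_prop
  have h1 : ∀ ε > 0, (s ε l m).im * normSq (mixedDet A V (dropAt B l m) (s ε)) ≤
      (mixedDet A V B (s ε) * conj (mixedDet A V (dropAt B l m) (s ε))).im := by
    intro ε hε
    have hsε : ∀ l i, 0 < (s ε l i).im := fun l i => by
      have := hz l i
      simp [s]; linarith
    exact im_mixedDet_mul_conj_of_ne_zero A hm hmV hsε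
      (mixedDet_ne_zero hA hV
        (fun v hv l' => mem_dropAt (hVB v hv l') (fun h : v = m => hmV (h ▸ hv))) hsε)
      (fun z hz => mixedDet_ne_zero hA hV hVB hz)
  have hl : Continuous fun ε => (s ε l m).im * normSq (mixedDet A V (dropAt B l m) (s ε)) :=
    (continuous_im.comp hw).mul (continuous_normSq.comp hd)
  have hr : Continuous fun ε =>
      (mixedDet A V B (s ε) * conj (mixedDet A V (dropAt B l m) (s ε))).im :=
    continuous_im.comp (hc.mul (continuous_conj.comp hd))
  have hlim := le_of_tendsto_of_tendsto (b := nhdsWithin (0 : ℝ) (Set.Ioi 0))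
    ((hl.tendsto 0).mono_left nhdsWithin_le_nhds)
    ((hr.tendsto 0).mono_left nhdsWithin_le_nhds)
    (Filter.eventually_of_mem self_mem_nhdsWithin h1)
  simpa only [hs0] using hlim

theorem mul_norm_mixedDet_dropAt_le [Nonempty κ] {A : Matrix ι ι ℂ} (hA : A.IsHermitian)
    {V : List ι} (hV : V.Nodup) {B : κ → Finset ι} (hVB : ∀ v ∈ V, ∀ l, v ∈ B l) {l : κ} {m : ι}
    (hm : m ∈ B l) (hmV : m ∉ V) {z : κ → ι → ℂ} (hz : ∀ l i, 0 ≤ (z l i).im) :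
    (z l m).im * ‖mixedDet A V (dropAt B l m) z‖ ≤ ‖mixedDet A V B z‖ := by
  have h := im_mixedDet_mul_conj hA hV hVB hm hmV hz
  set D := mixedDet A V (dropAt B l m) z
  set F := mixedDet A V B z
  by_cases hD : D = 0
  · simp [hD]
  have h1 : (F * conj D).im ≤ ‖F‖ * ‖D‖ := by
    refine (Complex.im_le_norm _).trans ?_
    rw [norm_mul, RCLike.norm_conj]
  rw [normSq_eq_norm_sq] at h
  have hpos : 0 < ‖D‖ := norm_pos_iff.mpr hD
  nlinarith

/-- Remove `k` from the members of the family `B` with index in `L`. -/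
def dropOn (B : κ → Finset ι) (k : ι) (L : Finset κ) : κ → Finset ι :=
  fun l => if l ∈ L then (B l).erase k else B l

/-- Deleting `k` from one colour at a time costs one factor `(z l k).im` each. This quantitative
form still excludes zeros when only the variables of `k` are nonreal, provided the fully deleted
determinant is nonzero. -/
theorem prod_im_mul_norm_mixedDet_dropAll_le [Nonempty κ] {A : Matrix ι ι ℂ} (hA : A.IsHermitian)
    {V : List ι} (hV : V.Nodup) {B : κ → Finset ι} (hVB : ∀ v ∈ V, ∀ l, v ∈ B l) {k : ι}
    (hk : ∀ l, k ∈ B l) (hkV : k ∉ V) {z : κ → ι → ℂ} (hz : ∀ l i, 0 ≤ (z l i).im) :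
    (∏ l, (z l k).im) * ‖mixedDet A V (dropAll B k) z‖ ≤ ‖mixedDet A V B z‖ := by
  have key : ∀ L : Finset κ,
      (∏ l ∈ L, (z l k).im) * ‖mixedDet A V (dropOn B k L) z‖ ≤ ‖mixedDet A V B z‖ := by
    intro L
    induction L using Finset.induction_on with
    | empty => simp [show dropOn B k ∅ = B by ext; simp [dropOn]]
    | insert a L ha ih =>
      rw [Finset.prod_insert ha, mul_comm (z a k).im, mul_assoc]
      refine le_trans (mul_le_mul_of_nonneg_left ?_ (Finset.prod_nonneg fun l _ => hz l k)) ih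
      have hd : dropOn B k (insert a L) = dropAt (dropOn B k L) a k := by
        ext l x
        by_cases h : l = a
        · subst h; simp [dropOn, dropAt, ha]
        · simp [dropOn, dropAt, h]
      rw [hd]
      refine mul_norm_mixedDet_dropAt_le hA hV (fun v hv l => ?_) ?_ hkV hz
      · have : v ≠ k := fun h => hkV (h ▸ hv)
        unfold dropOn; split_ifs <;> simp [this, hVB v hv l]
      · simp [dropOn, ha, hk]
  have := key Finset.univ
  rwa [show dropOn B k Finset.univ = dropAll B k by ext; simp [dropOn, dropAll]] at this

theorem principalDet_conj {A : Matrix ι ι ℂ} (hA : A.IsHermitian) (B : Finset ι) (z : ι → ℂ) :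
    principalDet A B (fun i => conj (z i)) = conj (principalDet A B z) := by
  unfold principalDet
  have h := Matrix.det_conjTranspose (maskedMatrix A B z)
  rw [starRingEnd_apply, ← h]
  congr 1
  ext i j
  have hij : star (A j i) = A i j := hA.apply i j
  simp only [maskedMatrix, Matrix.of_apply, Matrix.conjTranspose_apply]
  by_cases h1 : i = j
  · subst h1; by_cases h2 : i ∈ B <;> simp [h2]; simpa using hij.symm
  · simp only [h1, Ne.symm h1, and_comm (a := j ∈ B), if_false]
    split_ifs <;> simp; simpa using hij.symm

theorem mixedDet_conj {A : Matrix ι ι ℂ} (hA : A.IsHermitian) (V : List ι) (B : κ → Finset ι)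
    (z : κ → ι → ℂ) :
    mixedDet A V B (fun l i => conj (z l i)) = conj (mixedDet A V B z) := by
  induction V generalizing B with
  | nil => simp [mixedDet, principalDet_conj hA, map_prod]
  | cons k V ih => simp [mixedDet, ih, map_sum]

theorem im_mixedDet_ofReal {A : Matrix ι ι ℂ} (hA : A.IsHermitian) (V : List ι)
    (B : κ → Finset ι) (x : κ → ι → ℝ) :
    (mixedDet A V B (fun l i => (x l i : ℂ))).im = 0 := by
  have := mixedDet_conj hA V B (fun l i => (x l i : ℂ))
  simp only [conj_ofReal] at this
  exact Complex.conj_eq_iff_im.mp this.symm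

end Stability

/-! ### Partial fractions of rational functions preserving a half plane. -/

section PartialFractions

open Complex ComplexConjugate Polynomial

/-- Already squaring doubles the arguments in `[0, π]` and so reaches every direction. This is what
rules out multiple poles. -/
theorem exists_pow_eq_of_two_le {m : ℕ} (hm : 2 ≤ m) {w : ℂ} (hw : w ≠ 0) :
    ∃ (ζ : ℂ) (c : ℝ), 0 ≤ ζ.im ∧ 0 < c ∧ ζ ^ m = c * w := by
  obtain ⟨θ, h0, h2, hθ⟩ : ∃ θ : ℝ, 0 ≤ θ ∧ θ ≤ 2 * Real.pi ∧ w = ‖w‖ * exp (θ * I) := by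
    by_cases h : 0 ≤ arg w
    · exact ⟨arg w, h, by linarith [arg_le_pi w, Real.pi_pos], (norm_mul_exp_arg_mul_I w).symm⟩
    · refine ⟨arg w + 2 * Real.pi, by linarith [neg_pi_lt_arg w, Real.pi_pos],
        by push Not at h; linarith, ?_⟩
      have : ((arg w + 2 * Real.pi : ℝ) : ℂ) * I = arg w * I + 2 * Real.pi * I := by
        push_cast; ring
      rw [this, exp_periodic, norm_mul_exp_arg_mul_I]
  have hm0 : (0 : ℝ) < m := by positivity
  refine ⟨exp ((θ / m : ℝ) * I), ‖w‖⁻¹, ?_, by positivity, ?_⟩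
  · rw [exp_ofReal_mul_I_im]
    refine Real.sin_nonneg_of_nonneg_of_le_pi (by positivity) ?_
    rw [div_le_iff₀ hm0]
    have : (2 : ℝ) ≤ m := by exact_mod_cast hm
    nlinarith [Real.pi_pos]
  · rw [← exp_nat_mul]
    have e : (m : ℂ) * ((θ / m : ℝ) * I) = θ * I := by
      have : (m : ℂ) ≠ 0 := by exact_mod_cast hm0.ne'
      push_cast; field_simp
    rw [e]
    have hn : (‖w‖ : ℂ) ≠ 0 := by simpa using hw
    conv_rhs => rw [hθ]
    push_cast
    rw [norm_mul, norm_exp_ofReal_mul_I]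
    simp only [norm_real, norm_norm, mul_one]
    rw [inv_mul_cancel_left₀ hn]

/-- Behaviour of a quotient `q / ((X - a) ^ m * g)` with nonpositive imaginary part on the upper
half plane near the real point `a`. -/
theorem im_eval_mul_conj_pow_nonpos {q g : ℂ[X]} {a : ℝ} {m : ℕ}
    (h : ∀ y : ℂ, 0 < y.im → (q.eval y * conj ((y - a) ^ m * g.eval y)).im ≤ 0)
    {ζ : ℂ} (hζ : 0 ≤ ζ.im) :
    (q.eval (a : ℂ) * conj (g.eval (a : ℂ)) * conj (ζ ^ m)).im ≤ 0 := by
  have key : ∀ ζ : ℂ, 0 < ζ.im →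
      (q.eval (a : ℂ) * conj (g.eval (a : ℂ)) * conj (ζ ^ m)).im ≤ 0 := by
    intro ζ hζ
    -- Along the ray `a + ρ * ζ` the singular factor contributes only the positive scalar `ρ ^ m`,
    -- which can be cancelled before `ρ → 0`.
    have h1 : ∀ ρ : ℝ, 0 < ρ →
        (q.eval (a + ρ * ζ) * conj (g.eval (a + ρ * ζ)) * conj (ζ ^ m)).im ≤ 0 := by
      intro ρ hρ
      have h2 := h (a + ρ * ζ) (by simpa using mul_pos hρ hζ)
      have h3 : q.eval (a + ρ * ζ) * conj ((a + ρ * ζ - a) ^ m * g.eval (a + ρ * ζ)) =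
          ((ρ ^ m : ℝ) : ℂ) *
            (q.eval (a + ρ * ζ) * conj (g.eval (a + ρ * ζ)) * conj (ζ ^ m)) := by
        rw [add_sub_cancel_left, mul_pow]
        simp only [map_mul, map_pow, conj_ofReal]
        push_cast; ring
      rw [h3, im_ofReal_mul] at h2
      have : 0 < ρ ^ m := by positivity
      exact nonpos_of_mul_nonpos_right h2 this
    have hc : Continuous fun ρ : ℝ =>
        (q.eval (a + ρ * ζ) * conj (g.eval (a + ρ * ζ)) * conj (ζ ^ m)).im := by
      have hl : Continuous fun ρ : ℝ => (a : ℂ) + ρ * ζ := by fun_prop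
      exact continuous_im.comp (((q.continuous.comp hl).mul
        (continuous_conj.comp (g.continuous.comp hl))).mul continuous_const)
    have hlim := le_of_tendsto (x := nhdsWithin (0 : ℝ) (Set.Ioi 0))
      ((hc.tendsto 0).mono_left nhdsWithin_le_nhds)
      (Filter.eventually_of_mem self_mem_nhdsWithin fun ρ hρ => h1 ρ hρ)
    simpa using hlim
  have hc : Continuous fun ε : ℝ =>
      (q.eval (a : ℂ) * conj (g.eval (a : ℂ)) * conj ((ζ + ε * I) ^ m)).im := by
    refine continuous_im.comp (continuous_const.mul (continuous_conj.comp ?_))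
    fun_prop
  have hlim := le_of_tendsto (x := nhdsWithin (0 : ℝ) (Set.Ioi 0))
    ((hc.tendsto 0).mono_left nhdsWithin_le_nhds)
    (Filter.eventually_of_mem self_mem_nhdsWithin fun ε (hε : 0 < ε) =>
      key (ζ + ε * I) (by simp; linarith))
  simpa using hlim

theorem im_eq_zero_re_nonneg_of_im_mul_conj_nonpos {κ : ℂ}
    (h : ∀ ζ : ℂ, 0 ≤ ζ.im → (κ * conj ζ).im ≤ 0) : κ.im = 0 ∧ 0 ≤ κ.re := by
  have h1 := h 1 (by simp)
  have h2 := h (-1) (by simp)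
  have h3 := h I (by simp)
  simp at h1 h2 h3
  exact ⟨le_antisymm h1 h2, h3⟩

/-- Partial fraction decomposition, with nonnegative coefficients, of a proper rational function
with real poles that maps the upper half plane to the closed lower half plane. -/
theorem exists_partialFractions {σ : Type*} [DecidableEq σ] (s : Finset σ) (a : σ → ℝ) (q : ℂ[X])
    (hdeg : q.degree < s.card)
    (h : ∀ y : ℂ, 0 < y.im → (q.eval y * conj (∏ i ∈ s, (y - a i))).im ≤ 0) :
    ∃ c : σ → ℝ, (∀ i ∈ s, 0 ≤ c i) ∧
      q = ∑ i ∈ s, C (c i : ℂ) * ∏ j ∈ s.erase i, (X - C (a j : ℂ)) := by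
  induction s using Finset.strongInduction generalizing q with
  | H s ih =>
  by_cases hcommon : ∃ i ∈ s, q.eval (a i : ℂ) = 0
  · obtain ⟨i, hi, hqi⟩ := hcommon
    obtain ⟨q1, rfl⟩ := dvd_iff_isRoot.mpr hqi
    have hcard : s.card = (s.erase i).card + 1 := (Finset.card_erase_add_one hi).symm
    have hdeg1 : q1.degree < (s.erase i).card := by
      rw [hcard, degree_mul, degree_X_sub_C] at hdeg
      by_cases h0 : q1 = 0
      · simp [h0]
      · rw [degree_eq_natDegree h0] at hdeg ⊢
        norm_cast at hdeg ⊢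
        omega
    obtain ⟨c, hc, hq⟩ := ih (s.erase i) (Finset.erase_ssubset hi) q1 hdeg1 fun y hy => by
      have h1 := h y hy
      rw [← Finset.mul_prod_erase s _ hi] at h1
      have h2 : (((X - C (a i : ℂ)) * q1).eval y *
          conj ((y - a i) * ∏ x ∈ s.erase i, (y - a x))) =
          ((normSq (y - a i) : ℝ) : ℂ) * (q1.eval y * conj (∏ x ∈ s.erase i, (y - a x))) := by
        rw [← mul_conj]
        simp only [eval_mul, eval_sub, eval_X, eval_C, map_mul]
        ring
      rw [h2, im_ofReal_mul] at h1
      refine nonpos_of_mul_nonpos_right h1 (normSq_pos.mpr fun h0 => ?_)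
      have := congrArg im h0
      simp at this
      exact hy.ne' this
    -- The factor `X - a i` cancels from the quotient, so this pole gets coefficient `0`.
    refine ⟨Function.update c i 0, fun j hj => ?_, ?_⟩
    · by_cases hji : j = i
      · subst hji; simp
      · simpa [hji] using hc j (Finset.mem_erase.mpr ⟨hji, hj⟩)
    · rw [← Finset.add_sum_erase _ _ hi, Function.update_self]
      simp only [ofReal_zero, C_0, zero_mul, zero_add]
      conv_lhs => rw [hq]
      rw [Finset.mul_sum]
      refine Finset.sum_congr rfl fun j hj => ?_
      have hji := Finset.ne_of_mem_erase hj
      rw [Function.update_of_ne hji, Finset.erase_right_comm,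
        ← Finset.mul_prod_erase (s.erase j) _ (Finset.mem_erase.mpr ⟨hji.symm, hi⟩)]
      ring
  · push Not at hcommon
    have hinj : Set.InjOn a s := by
      intro i hi j hj hij
      by_contra hne
      set T := s.filter fun l => a l = a i
      have hT : 2 ≤ T.card := by
        refine Finset.one_lt_card.mpr ⟨i, ?_, j, ?_, hne⟩
        · simpa [T] using hi
        · simpa [T, hij] using hj
      set g : ℂ[X] := ∏ l ∈ s.filter (fun l => ¬ a l = a i), (X - C (a l : ℂ))
      have hg : g.eval (a i : ℂ) ≠ 0 := by
        simp only [g, eval_prod, eval_sub, eval_X, eval_C]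
        refine Finset.prod_ne_zero_iff.mpr fun l hl => ?_
        rw [sub_ne_zero]
        exact_mod_cast Ne.symm (Finset.mem_filter.mp hl).2
      have hprod : ∀ y : ℂ, ∏ l ∈ s, (y - a l) = (y - a i) ^ T.card * g.eval y := by
        intro y
        rw [← Finset.prod_filter_mul_prod_filter_not s (fun l => a l = a i)]
        simp only [g, eval_prod, eval_sub, eval_X, eval_C]
        congr 1
        rw [Finset.prod_congr rfl (g := fun _ => y - a i), Finset.prod_const]
        intro l hl
        rw [(Finset.mem_filter.mp hl).2]
      set κ := q.eval (a i : ℂ) * conj (g.eval (a i : ℂ))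
      have hκ : κ ≠ 0 := mul_ne_zero (hcommon i hi) (by simpa using hg)
      -- At a multiple pole, a direction with `ζ ^ m` a positive multiple of `-I * κ` turns `κ *
      -- conj (ζ ^ m)` into a positive multiple of `I`, against the sign hypothesis.
      obtain ⟨ζ, c, hζ, hc, hpow⟩ := exists_pow_eq_of_two_le hT
        (mul_ne_zero (neg_ne_zero.mpr I_ne_zero) hκ)
      have h1 := im_eval_mul_conj_pow_nonpos (m := T.card) (g := g) (a := a i)
        (fun y hy => hprod y ▸ h y hy) hζ
      rw [hpow] at h1
      have h2 : κ * conj (c * (-I * κ)) = ((c * normSq κ : ℝ) : ℂ) * I := by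
        simp only [map_mul, conj_ofReal, map_neg, conj_I]
        push_cast
        rw [← mul_conj]; ring
      change (κ * _).im ≤ 0 at h1
      rw [h2, im_ofReal_mul] at h1
      simp only [I_im, mul_one] at h1
      exact absurd h1 (not_le.mpr (mul_pos hc (normSq_pos.mpr hκ)))
    have hinj' : Set.InjOn (fun i => (a i : ℂ)) s := fun i hi j hj hij =>
      hinj hi hj (by simpa using hij)
    set g : σ → ℂ := fun i => ∏ j ∈ s.erase i, ((a i : ℂ) - a j)
    have hg : ∀ i ∈ s, g i ≠ 0 := by
      intro i hi
      refine Finset.prod_ne_zero_iff.mpr fun l hl => sub_ne_zero.mpr fun h0 => ?_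
      exact Finset.ne_of_mem_erase hl (hinj' hi (Finset.mem_of_mem_erase hl) h0).symm
    have hres : ∀ i ∈ s, ∃ c : ℝ, 0 ≤ c ∧ q.eval (a i : ℂ) = c * g i := by
      intro i hi
      have h1 : ∀ y : ℂ, ∏ l ∈ s, (y - a l) =
          (y - a i) ^ 1 * (∏ j ∈ s.erase i, (X - C (a j : ℂ))).eval y := by
        intro y
        simp only [eval_prod, eval_sub, eval_X, eval_C, pow_one]
        rw [Finset.mul_prod_erase s (fun l => y - (a l : ℂ)) hi]
      have h2 := im_eq_zero_re_nonneg_of_im_mul_conj_nonpos fun ζ hζ => by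
        have h3 := im_eval_mul_conj_pow_nonpos (m := 1) (a := a i)
          (fun y hy => h1 y ▸ h y hy) hζ
        simp only [pow_one, eval_prod, eval_sub, eval_X, eval_C] at h3
        exact h3
      have hn : (0 : ℝ) < normSq (g i) := normSq_pos.mpr (hg i hi)
      refine ⟨(q.eval (a i : ℂ) * conj (g i)).re / normSq (g i), div_nonneg h2.2 hn.le, ?_⟩
      have h4 : (((q.eval (a i : ℂ) * conj (g i)).re : ℝ) : ℂ) = q.eval (a i : ℂ) * conj (g i) :=
        Complex.ext rfl h2.1.symm
      push_cast
      rw [h4, ← mul_conj]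
      have hgc : conj (g i) ≠ 0 := by simpa using hg i hi
      have := hg i hi
      field_simp
    choose! c hc0 hc using hres
    refine ⟨c, hc0, ?_⟩
    -- The poles are now distinct, so Lagrange interpolation with the residues as coefficients
    -- identifies `q`.
    refine eq_of_degrees_lt_of_eval_index_eq s hinj' hdeg ?_ fun i hi => ?_
    · refine (degree_sum_le _ _).trans_lt ?_
      refine (Finset.sup_lt_iff (WithBot.bot_lt_coe _)).mpr fun i hi => ?_
      refine (degree_mul_le _ _).trans_lt ((add_le_add degree_C_le le_rfl).trans_lt ?_)
      rw [degree_prod, zero_add]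
      simp only [degree_X_sub_C, Finset.sum_const, nsmul_one]
      exact_mod_cast Finset.card_erase_lt_of_mem hi
    · rw [hc i hi, eval_finsetSum, Finset.sum_eq_single_of_mem i hi]
      · simp [eval_prod, g]
      · intro j hj hji
        simp only [eval_mul, eval_C, eval_prod, eval_sub, eval_X]
        rw [Finset.prod_eq_zero (i := i) (Finset.mem_erase.mpr ⟨hji.symm, hi⟩) (sub_self _),
          mul_zero]

end PartialFractions

/-! ### One-variable slices and the polar part. -/

section Slices

open Polynomial

theorem coeff_prod_affine {σ : Type*} [DecidableEq σ] (a b : σ → ℂ) (s : Finset σ) :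
    (∏ j ∈ s, (C (a j) * X + C (b j))).coeff s.card = ∏ j ∈ s, a j := by
  have := coeff_prod_of_natDegree_le (s := s) (fun j => C (a j) * X + C (b j)) 1
    (fun j _ => natDegree_linear_le)
  simpa using this

theorem coeff_prod_affine_of_card_eq {σ : Type*} [DecidableEq σ] (a b : σ → ℂ) (s : Finset σ)
    (m : ℕ) (hm : s.card = m + 1) :
    (∏ j ∈ s, (C (a j) * X + C (b j))).coeff m = ∑ j ∈ s, b j * ∏ i ∈ s.erase j, a i := by
  induction s using Finset.induction_on generalizing m with
  | empty => simp at hm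
  | insert x s hx ih =>
    rw [Finset.card_insert_of_notMem hx] at hm
    have hs : s.card = m := by omega
    rw [Finset.prod_insert hx, Finset.sum_insert hx, Finset.erase_insert hx]
    have hsum : ∑ j ∈ s, b j * ∏ i ∈ (insert x s).erase j, a i =
        a x * ∑ j ∈ s, b j * ∏ i ∈ s.erase j, a i := by
      rw [Finset.mul_sum]
      refine Finset.sum_congr rfl fun j hj => ?_
      have hjx : x ≠ j := fun h => hx (h ▸ hj)
      rw [Finset.erase_insert_of_ne hjx, Finset.prod_insert (by simp [hx])]
      ring
    rw [hsum]
    have hcoeff := coeff_prod_affine a b s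
    rw [hs] at hcoeff
    cases m with
    | zero =>
      obtain rfl := Finset.card_eq_zero.mp hs
      simp
    | succ m =>
      rw [add_mul, coeff_add, mul_assoc, coeff_C_mul, coeff_C_mul, coeff_X_mul, hcoeff, ih m hs,
        add_comm]

/-- For `p = c ∏ (X - a j)` of degree `r`, this is the linear polynomial `c ∑ (X - a j)`. -/
noncomputable def polarPart (r : ℕ) : ℂ[X] →ₗ[ℂ] ℂ[X] where
  toFun p := C (r * p.coeff r) * X + C (p.coeff (r - 1))
  map_add' p q := by simp only [coeff_add, mul_add, map_add]; ring
  map_smul' c p := by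
    simp only [coeff_C_mul, map_mul, RingHom.id_apply, smul_eq_C_mul]; ring

/-- Stated without requiring `a j ≠ 0`, so that factors of degree zero are covered too. -/
theorem polarPart_prod_affine {σ : Type*} [Fintype σ] [DecidableEq σ] [Nonempty σ] (a b : σ → ℂ) :
    polarPart (Fintype.card σ) (∏ j, (C (a j) * X + C (b j))) =
      ∑ j, (C (a j) * X + C (b j)) * ∏ i ∈ Finset.univ.erase j, C (a i) := by
  have h1 := coeff_prod_affine a b Finset.univ
  have h2 := coeff_prod_affine_of_card_eq a b Finset.univ (Fintype.card σ - 1)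
    (Nat.sub_add_cancel Fintype.card_pos).symm
  rw [Finset.card_univ] at h1
  change C _ * X + C _ = _
  rw [h1, h2]
  simp only [add_mul, Finset.sum_add_distrib, map_sum, map_mul, map_prod, map_natCast]
  congr 1
  have : ∀ j, C (a j) * X * ∏ i ∈ Finset.univ.erase j, C (a i) = (∏ i, C (a i)) * X := by
    intro j
    rw [← Finset.mul_prod_erase Finset.univ (fun i => C (a i)) (Finset.mem_univ j)]
    ring
  simp only [this, Finset.sum_const, Finset.card_univ, nsmul_eq_mul]
  ring

variable {ι κ : Type*} [Fintype ι] [DecidableEq ι] [Fintype κ] [DecidableEq κ]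

/-- The mixed determinant as a polynomial in the variable with index `k`. -/
noncomputable def slice (A : Matrix ι ι ℂ) (V : List ι) (B : κ → Finset ι) (k : ι) (z : ι → ℂ) :
    ℂ[X] :=
  mixedDet A V B fun _ => Function.update (fun i => C (z i)) k X

theorem eval_slice (A : Matrix ι ι ℂ) (V : List ι) (B : κ → Finset ι) (k : ι) (z : ι → ℂ) (y : ℂ) :
    (slice A V B k z).eval y = mixedDet A V B fun _ => Function.update z k y := by
  have h := map_mixedDet (aeval y : ℂ[X] →ₐ[ℂ] ℂ) A V B
    (fun _ => Function.update (fun i => C (z i)) k X)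
  rw [slice, ← coe_aeval_eq_eval, h]
  congr 1
  ext l i
  by_cases hi : i = k
  · subst hi; simp
  · simp [hi]

theorem slice_cons (A : Matrix ι ι ℂ) (m : ι) (V : List ι) (B : κ → Finset ι) (k : ι)
    (z : ι → ℂ) : slice A (m :: V) B k z = ∑ j, slice A V (keepOnly B m j) k z := rfl

theorem principalDet_C (A : Matrix ι ι ℂ) (B : Finset ι) (z : ι → ℂ) :
    principalDet A B (fun i => (C (z i) : ℂ[X])) = C (principalDet A B z) :=
  (map_principalDet (CAlgHom : ℂ →ₐ[ℂ] ℂ[X]) A B z).symm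

theorem principalDet_update_X (A : Matrix ι ι ℂ) {B : Finset ι} {k : ι} (hk : k ∈ B)
    (z : ι → ℂ) :
    principalDet A B (Function.update (fun i => (C (z i) : ℂ[X])) k X) =
      C (principalDet A (B.erase k) z) * X + C (principalDet A B (Function.update z k 0)) := by
  rw [principalDet_update A hk, principalDet_C, mul_comm, ← principalDet_C A B]
  congr 2
  ext i : 1
  by_cases hi : i = k
  · subst hi; simp
  · simp [hi]

theorem principalDet_update_erase (A : Matrix ι ι ℂ) (B : Finset ι) (k : ι) (z : ι → ℂ) :
    principalDet A (B.erase k) (Function.update (fun i => (C (z i) : ℂ[X])) k X) =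
      C (principalDet A (B.erase k) z) := by
  rw [← principalDet_C]
  refine principalDet_congr A _ fun i hi => ?_
  simp [Finset.ne_of_mem_erase hi]

theorem slice_nil (A : Matrix ι ι ℂ) {B : κ → Finset ι} {k : ι} (hk : ∀ l, k ∈ B l) (z : ι → ℂ) :
    slice A [] B k z = ∏ l, (C (principalDet A ((B l).erase k) z) * X +
      C (principalDet A (B l) (Function.update z k 0))) :=
  Finset.prod_congr rfl fun l _ => principalDet_update_X A (hk l) z

theorem natDegree_slice_le (A : Matrix ι ι ℂ) {V : List ι} {B : κ → Finset ι} {k : ι}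
    (hk : ∀ l, k ∈ B l) (hkV : k ∉ V) (z : ι → ℂ) :
    (slice A V B k z).natDegree ≤ Fintype.card κ := by
  induction V generalizing B with
  | nil =>
    rw [slice_nil A hk]
    refine (natDegree_prod_le _ _).trans ((Finset.sum_le_card_nsmul _ _ 1 fun l _ => ?_).trans ?_)
    · exact natDegree_linear_le
    · simp
  | cons m V ih =>
    simp only [List.mem_cons, not_or] at hkV
    rw [slice_cons]
    exact natDegree_sum_le_of_forall_le _ _ fun j _ =>
      ih (fun l => mem_keepOnly (hk l) hkV.1) hkV.2

theorem coeff_slice_card (A : Matrix ι ι ℂ) {V : List ι} {B : κ → Finset ι} {k : ι}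
    (hk : ∀ l, k ∈ B l) (hkV : k ∉ V) (z : ι → ℂ) :
    (slice A V B k z).coeff (Fintype.card κ) = mixedDet A V (dropAll B k) fun _ => z := by
  induction V generalizing B with
  | nil =>
    rw [slice_nil A hk, ← Finset.card_univ, coeff_prod_affine]
    rfl
  | cons m V ih =>
    simp only [List.mem_cons, not_or] at hkV
    rw [slice_cons, finsetSum_coeff, mixedDet]
    refine Finset.sum_congr rfl fun j _ => ?_
    rw [ih (fun l => mem_keepOnly (hk l) hkV.1) hkV.2, keepOnly_dropAll_comm]

theorem derivative_slice (A : Matrix ι ι ℂ) {V : List ι} {B : κ → Finset ι} {k : ι}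
    (hk : ∀ l, k ∈ B l) (hkV : k ∉ V) (z : ι → ℂ) :
    derivative (slice A V B k z) = ∑ l, slice A V (dropAt B l k) k z := by
  induction V generalizing B with
  | nil =>
    rw [slice_nil A hk, derivative_prod_finset]
    refine Finset.sum_congr rfl fun l _ => ?_
    rw [slice, mixedDet, ← Finset.mul_prod_erase Finset.univ _ (Finset.mem_univ l), mul_comm]
    congr 1
    · simp [dropAt, principalDet_update_erase]
    · refine Finset.prod_congr rfl fun i hi => ?_
      rw [dropAt, Function.update_of_ne (Finset.ne_of_mem_erase hi), principalDet_update_X A (hk i)]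
  | cons m V ih =>
    simp only [List.mem_cons, not_or] at hkV
    simp only [slice_cons, derivative_sum]
    rw [Finset.sum_comm]
    refine Finset.sum_congr rfl fun j _ => ?_
    rw [ih (fun l => mem_keepOnly (hk l) hkV.1) hkV.2]
    simp only [keepOnly_dropAt_comm]

/-- For empty `V` the slice is a product of affine factors whose leading coefficients are the
determinants with `k` deleted. The polar part keeps one factor and replaces the others by those
coefficients, which is exactly a choice of colour for `k`. Linearity and `keepOnly_comm` handle the
remaining points. -/
theorem polarPart_slice [Nonempty κ] (A : Matrix ι ι ℂ) {V : List ι} {B : κ → Finset ι} {k : ι}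
    (hk : ∀ l, k ∈ B l) (hkV : k ∉ V) (z : ι → ℂ) :
    polarPart (Fintype.card κ) (slice A V B k z) = slice A (k :: V) B k z := by
  induction V generalizing B with
  | nil =>
    rw [slice_nil A hk, polarPart_prod_affine, slice_cons]
    refine Finset.sum_congr rfl fun l _ => ?_
    rw [slice, mixedDet, ← Finset.mul_prod_erase Finset.univ _ (Finset.mem_univ l)]
    congr 1
    · simp [keepOnly, principalDet_update_X A (hk l)]
    · refine Finset.prod_congr rfl fun i hi => ?_
      rw [keepOnly, if_neg (Finset.ne_of_mem_erase hi), principalDet_update_erase]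
  | cons m V ih =>
    simp only [List.mem_cons, not_or] at hkV
    rw [slice_cons, map_sum]
    simp only [slice_cons A k, slice_cons A m]
    rw [Finset.sum_comm]
    refine Finset.sum_congr rfl fun j _ => ?_
    rw [ih (fun l => mem_keepOnly (hk l) hkV.1) hkV.2, slice_cons]
    exact Finset.sum_congr rfl fun i _ => by rw [keepOnly_comm]

end Slices

/-! ### Resolvent bound for a positive contraction. -/

section Resolvent

open Complex ComplexConjugate

/-- This is `T² ≤ T`, read off from positivity of `T` at `e - T e` together with `⟨T (T e), T e⟩ ≤
‖T e‖²`. -/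
theorem norm_sq_le_re_inner_of_contraction {E : Type*} [NormedAddCommGroup E]
    [InnerProductSpace ℂ E] {T : E →L[ℂ] E} (hT : (T : E →ₗ[ℂ] E).IsPositive) (h1 : ‖T‖ ≤ 1)
    (e : E) : ‖T e‖ ^ 2 ≤ (inner ℂ (T e) e).re := by
  have hpos : ∀ v, 0 ≤ (inner ℂ (T v) v).re := fun v => hT.2 v
  have hle : (inner ℂ (T (T e)) (T e)).re ≤ ‖T e‖ ^ 2 := by
    refine (re_inner_le_norm (𝕜 := ℂ) _ _).trans ?_
    have := T.le_of_opNorm_le h1 (T e)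
    nlinarith [norm_nonneg (T e)]
  have h2 := hpos (e - T e)
  have hsymm : (inner ℂ (T (T e)) e).re = ‖T e‖ ^ 2 := by
    rw [show inner ℂ (T (T e)) e = inner ℂ (T e) (T e) from hT.1 _ _]
    exact (norm_sq_eq_re_inner (𝕜 := ℂ) (T e)).symm
  have hself : (inner ℂ (T e) (T e)).re = ‖T e‖ ^ 2 :=
    (norm_sq_eq_re_inner (𝕜 := ℂ) (T e)).symm
  simp only [map_sub, inner_sub_left, inner_sub_right, sub_re] at h2
  linarith

/-- Variational form of the bound `⟪e, (t - T)⁻¹ e⟫ ≤ 1 / t + α / (t * (t - 1))`. -/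
theorem two_mul_re_inner_sub_le {E : Type*} [NormedAddCommGroup E] [InnerProductSpace ℂ E]
    {T : E →L[ℂ] E} (hT : (T : E →ₗ[ℂ] E).IsPositive) (h1 : ‖T‖ ≤ 1) {t α : ℝ} (ht : 1 < t)
    {e : E} (he : ‖e‖ = 1) (hα : (inner ℂ (T e) e).re ≤ α) (u : E) :
    2 * (inner ℂ e u).re - t * ‖u‖ ^ 2 + (inner ℂ (T u) u).re ≤ 1 / t + α / (t * (t - 1)) := by
  -- Centring at the maximizer for `T = 0` removes the linear terms in `⟨e, v⟩`. What remains is a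
  -- cross term `⟨T e, v⟩`, absorbed by `(t - 1) ‖v‖²`.
  obtain ⟨v, rfl⟩ : ∃ v, u = ((t⁻¹ : ℝ) : ℂ) • e + v := ⟨u - ((t⁻¹ : ℝ) : ℂ) • e, by abel⟩
  have ht0 : 0 < t := by linarith
  have hs : 0 < t - 1 := by linarith
  have hTe := norm_sq_le_re_inner_of_contraction hT h1 e
  have hTv : (inner ℂ (T v) v).re ≤ ‖v‖ ^ 2 := by
    refine (re_inner_le_norm (𝕜 := ℂ) _ _).trans ?_
    have := T.le_of_opNorm_le h1 v
    nlinarith [norm_nonneg v]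
  have hee : (inner ℂ e e).re = 1 := by
    rw [show (inner ℂ e e).re = ‖e‖ ^ 2 from (norm_sq_eq_re_inner (𝕜 := ℂ) e).symm, he, one_pow]
  have hvv : (inner ℂ v v).re = ‖v‖ ^ 2 := (norm_sq_eq_re_inner (𝕜 := ℂ) v).symm
  have hve : (inner ℂ v e).re = (inner ℂ e v).re := inner_re_symm (𝕜 := ℂ) _ _
  have hTve : (inner ℂ (T v) e).re = (inner ℂ (T e) v).re := by
    rw [show inner ℂ (T v) e = inner ℂ v (T e) from hT.1 _ _]
    exact inner_re_symm (𝕜 := ℂ) _ _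
  have hcs : (inner ℂ (T e) v).re ≤ ‖T e‖ * ‖v‖ := re_inner_le_norm (𝕜 := ℂ) _ _
  have hn : ‖((t⁻¹ : ℝ) : ℂ) • e + v‖ ^ 2 =
      t⁻¹ ^ 2 + 2 * t⁻¹ * (inner ℂ e v).re + ‖v‖ ^ 2 := by
    rw [norm_sq_eq_re_inner (𝕜 := ℂ)]
    simp only [inner_add_left, inner_add_right, inner_smul_left, inner_smul_right, conj_ofReal,
      RCLike.re_to_complex, add_re, re_ofReal_mul, hee, hvv, hve]
    ring
  have e1 : (inner ℂ e (((t⁻¹ : ℝ) : ℂ) • e + v)).re = t⁻¹ + (inner ℂ e v).re := by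
    simp only [inner_add_right, inner_smul_right, add_re, re_ofReal_mul, hee, mul_one]
  have e2 : (inner ℂ (T (((t⁻¹ : ℝ) : ℂ) • e + v)) (((t⁻¹ : ℝ) : ℂ) • e + v)).re =
      t⁻¹ ^ 2 * (inner ℂ (T e) e).re + 2 * t⁻¹ * (inner ℂ (T e) v).re + (inner ℂ (T v) v).re := by
    simp only [map_add, map_smul, inner_add_left, inner_add_right, inner_smul_left,
      inner_smul_right, conj_ofReal, add_re, re_ofReal_mul, hTve]
    ring
  rw [hn, e1, e2]
  have hq : 2 * t⁻¹ * (‖T e‖ * ‖v‖) ≤ (t - 1) * ‖v‖ ^ 2 + t⁻¹ ^ 2 * ‖T e‖ ^ 2 / (t - 1) := by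
    have : 0 ≤ ((t - 1) * ‖v‖ - t⁻¹ * ‖T e‖) ^ 2 / (t - 1) := by positivity
    have e3 : ((t - 1) * ‖v‖ - t⁻¹ * ‖T e‖) ^ 2 / (t - 1) =
        (t - 1) * ‖v‖ ^ 2 + t⁻¹ ^ 2 * ‖T e‖ ^ 2 / (t - 1) - 2 * t⁻¹ * (‖T e‖ * ‖v‖) := by
      field_simp; ring
    linarith
  have hq2 : t⁻¹ ^ 2 * ‖T e‖ ^ 2 / (t - 1) ≤ t⁻¹ ^ 2 * α / (t - 1) := by
    gcongr; linarith
  have hq3 : t⁻¹ ^ 2 * (inner ℂ (T e) e).re ≤ t⁻¹ ^ 2 * α := by gcongr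
  have hq4 : 2 * t⁻¹ * (inner ℂ (T e) v).re ≤ 2 * t⁻¹ * (‖T e‖ * ‖v‖) := by gcongr
  have e4 : 1 / t + α / (t * (t - 1)) = t⁻¹ + t⁻¹ ^ 2 * α + t⁻¹ ^ 2 * α / (t - 1) := by
    field_simp; ring
  have e5 : t * (t⁻¹ ^ 2 + 2 * t⁻¹ * (inner ℂ e v).re + ‖v‖ ^ 2) =
      t⁻¹ + 2 * (inner ℂ e v).re + t * ‖v‖ ^ 2 := by
    field_simp
  rw [e4, e5]
  nlinarith

variable {ι : Type*} [Fintype ι] [DecidableEq ι]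

theorem star_dotProduct_maskedMatrix_mulVec (A : Matrix ι ι ℂ) (B : Finset ι) (z v : ι → ℂ) :
    star v ⬝ᵥ (maskedMatrix A B z).mulVec v =
      ∑ i, (if i ∈ B then z i else 1) * (normSq (v i) : ℂ) -
        star (fun i => if i ∈ B then v i else 0) ⬝ᵥ
          A.mulVec (fun i => if i ∈ B then v i else 0) := by
  simp only [dotProduct, Matrix.mulVec, ← Finset.sum_sub_distrib]
  refine Finset.sum_congr rfl fun i _ => ?_
  by_cases hi : i ∈ B
  · have h1 : ∀ j, maskedMatrix A B z i j * v j =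
        (if i = j then z i * v i else 0) - A i j * (if j ∈ B then v j else 0) := by
      intro j
      by_cases hj : j ∈ B
      · by_cases hij : i = j
        · subst hij; simp [maskedMatrix, hi, sub_mul]
        · simp [maskedMatrix, hi, hj, hij]
      · have : i ≠ j := fun h => hj (h ▸ hi)
        simp [maskedMatrix, hj, this]
    simp only [h1, Finset.sum_sub_distrib, normSq_eq_conj_mul_self]
    simp [hi, mul_sub]
    ring
  · simp [maskedMatrix, hi, normSq_eq_conj_mul_self]

omit [Fintype ι] in
theorem isHermitian_maskedMatrix {A : Matrix ι ι ℂ} (hA : A.IsHermitian) (B : Finset ι)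
    (x : ι → ℝ) : (maskedMatrix A B fun i => (x i : ℂ)).IsHermitian := by
  ext i j
  have hij : star (A j i) = A i j := hA.apply i j
  simp only [maskedMatrix, Matrix.of_apply, Matrix.conjTranspose_apply]
  by_cases h1 : i = j
  · subst h1; by_cases h2 : i ∈ B <;> simp [h2]; simpa using hij
  · simp only [h1, Ne.symm h1, and_comm (a := j ∈ B), if_false]
    split_ifs <;> simp; simpa using hij

theorem isPositive_toEuclideanCLM {A : Matrix ι ι ℂ} (hA : A.PosSemidef) :
    ((Matrix.toEuclideanCLM (𝕜 := ℂ) A : EuclideanSpace ℂ ι →L[ℂ] EuclideanSpace ℂ ι) :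
      EuclideanSpace ℂ ι →ₗ[ℂ] EuclideanSpace ℂ ι).IsPositive := by
  rw [Matrix.coe_toEuclideanCLM_eq_toEuclideanLin]
  exact Matrix.isPositive_toEuclideanLin_iff.mpr hA

theorem re_inner_toEuclideanCLM {A : Matrix ι ι ℂ} (hA : A.PosSemidef) (v : ι → ℂ) :
    (inner ℂ (Matrix.toEuclideanCLM (𝕜 := ℂ) A (WithLp.toLp 2 v)) (WithLp.toLp 2 v)).re =
      (star v ⬝ᵥ A.mulVec v).re := by
  have h : inner ℂ (Matrix.toEuclideanCLM (𝕜 := ℂ) A (WithLp.toLp 2 v)) (WithLp.toLp 2 v) =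
      inner ℂ (WithLp.toLp 2 v) (Matrix.toEuclideanCLM (𝕜 := ℂ) A (WithLp.toLp 2 v)) :=
    (isPositive_toEuclideanCLM hA).1 _ _
  rw [h, Matrix.toEuclideanCLM_toLp, EuclideanSpace.inner_toLp_toLp, dotProduct_comm]

theorem re_star_dotProduct_mulVec_le {A : Matrix ι ι ℂ} (hA : IsPSDContraction A) (v : ι → ℂ) :
    (star v ⬝ᵥ A.mulVec v).re ≤ ∑ i, normSq (v i) := by
  rw [← re_inner_toEuclideanCLM hA.1]
  refine (re_inner_le_norm (𝕜 := ℂ) _ _).trans ?_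
  have h1 := (Matrix.toEuclideanCLM (𝕜 := ℂ) A).le_of_opNorm_le hA.2 (WithLp.toLp 2 v)
  have h2 : ‖WithLp.toLp 2 v‖ ^ 2 = ∑ i, normSq (v i) := by
    rw [EuclideanSpace.norm_sq_eq]; simp [normSq_eq_norm_sq]
  nlinarith [norm_nonneg (WithLp.toLp 2 v)]

theorem posDef_maskedMatrix {A : Matrix ι ι ℂ} (hA : IsPSDContraction A) (B : Finset ι)
    {x : ι → ℝ} (hx : ∀ i, 1 < x i) : (maskedMatrix A B fun i => (x i : ℂ)).PosDef := by
  have hH := isHermitian_maskedMatrix hA.1.1 B x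
  refine Matrix.PosDef.of_dotProduct_mulVec_pos hH fun v hv => ?_
  rw [Complex.lt_def]
  refine ⟨?_, by simpa using (hH.im_star_dotProduct_mulVec_self v).symm⟩
  rw [star_dotProduct_maskedMatrix_mulVec, sub_re, re_sum]
  have h1 := re_star_dotProduct_mulVec_le hA (fun i => if i ∈ B then v i else 0)
  have h2 : ∑ i, normSq (if i ∈ B then v i else 0) <
      ∑ i, ((if i ∈ B then (x i : ℂ) else 1) * (normSq (v i) : ℂ)).re := by
    obtain ⟨i, hi⟩ := Function.ne_iff.mp hv
    refine Finset.sum_lt_sum (fun j _ => ?_) ⟨i, Finset.mem_univ i, ?_⟩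
    · rw [re_mul_ofReal]
      split_ifs
      · have := hx j
        simpa using le_mul_of_one_le_left (normSq_nonneg (v j)) this.le
      · simpa using normSq_nonneg (v j)
    · rw [re_mul_ofReal]
      have hp := normSq_pos.mpr hi
      split_ifs
      · have := hx i
        simp only [ofReal_re]
        nlinarith
      · simpa using hi
  rw [zero_re]
  linarith

theorem principalDet_pos {A : Matrix ι ι ℂ} (hA : IsPSDContraction A) (B : Finset ι)
    {x : ι → ℝ} (hx : ∀ i, 1 < x i) : 0 < principalDet A B fun i => (x i : ℂ) :=
  (posDef_maskedMatrix hA B hx).det_pos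

/-- By Cramer's rule the quotient of the determinants is the entry `u m` of the solution of `M u =
e_m`, which is supported on `B`. Since `u m = 2 u m - ⟨u, M u⟩` and the masked diagonal is at least
`t` on `B`, `two_mul_re_inner_sub_le` applies to `u`. -/
theorem principalDet_erase_le {A : Matrix ι ι ℂ} (hA : IsPSDContraction A) {B : Finset ι} {m : ι}
    (hm : m ∈ B) {t α : ℝ} (ht : 1 < t) (hα : (A m m).re ≤ α) {x : ι → ℝ} (hx : ∀ i, t ≤ x i) :
    (principalDet A (B.erase m) fun i => (x i : ℂ)).re ≤
      (1 / t + α / (t * (t - 1))) * (principalDet A B fun i => (x i : ℂ)).re := by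
  have hx1 : ∀ i, 1 < x i := fun i => ht.trans_le (hx i)
  have hP := principalDet_pos hA B hx1
  have hD := principalDet_pos hA (B.erase m) hx1
  have hadj := det_maskedMatrix_updateRow A B m (fun i => (x i : ℂ))
  have hM : (principalDet A B fun i => (x i : ℂ)) = (maskedMatrix A B fun i => (x i : ℂ)).det := rfl
  set M := maskedMatrix A B fun i => (x i : ℂ)
  set P := principalDet A B fun i => (x i : ℂ)
  set D := principalDet A (B.erase m) fun i => (x i : ℂ)
  have hPr : P = (P.re : ℂ) := Complex.ext rfl (by simpa using (Complex.lt_def.mp hP).2.symm)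
  have hDr : D = (D.re : ℂ) := Complex.ext rfl (by simpa using (Complex.lt_def.mp hD).2.symm)
  have hP0 : 0 < P.re := (Complex.lt_def.mp hP).1
  set u : ι → ℂ := P⁻¹ • M.adjugate.mulVec (Pi.single m 1)
  have hMu : M.mulVec u = Pi.single m 1 := by
    rw [Matrix.mulVec_smul, Matrix.mulVec_mulVec, Matrix.mul_adjugate, ← hM, Matrix.smul_mulVec,
      Matrix.one_mulVec, smul_smul, inv_mul_cancel₀ hP.ne', one_smul]
  have hum : u m = ((D.re / P.re : ℝ) : ℂ) := by
    have : M.adjugate.mulVec (Pi.single m 1) m = D := by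
      rw [Matrix.mulVec_single_one, Matrix.col_apply, Matrix.adjugate_apply, hadj]
    change P⁻¹ * _ = _
    rw [this]
    conv_lhs => rw [hPr, hDr]
    push_cast
    ring
  have hout : ∀ i ∉ B, u i = 0 := by
    intro i hi
    have h1 := congrFun hMu i
    have him : i ≠ m := fun h => hi (h ▸ hm)
    rw [Pi.single_eq_of_ne him] at h1
    simpa [Matrix.mulVec, dotProduct, M, maskedMatrix, hi] using h1
  have hmask : (fun i => if i ∈ B then u i else 0) = u := by
    ext i; split_ifs with h
    · rfl
    · exact (hout i h).symm
  have hquad : star u ⬝ᵥ M.mulVec u = ((D.re / P.re : ℝ) : ℂ) := by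
    rw [hMu, dotProduct_single_one, Pi.star_apply, hum]
    simp
  rw [star_dotProduct_maskedMatrix_mulVec, hmask] at hquad
  have hquad' := congrArg re hquad
  rw [sub_re, re_sum, ofReal_re] at hquad'
  have hsum : t * ∑ i, normSq (u i) ≤
      ∑ i, ((if i ∈ B then (x i : ℂ) else 1) * (normSq (u i) : ℂ)).re := by
    rw [Finset.mul_sum]
    refine Finset.sum_le_sum fun i _ => ?_
    rw [re_mul_ofReal]
    by_cases hi : i ∈ B
    · simpa [hi] using mul_le_mul_of_nonneg_right (hx i) (normSq_nonneg (u i))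
    · simp [hi, hout i hi]
  have hvar := two_mul_re_inner_sub_le (isPositive_toEuclideanCLM hA.1) hA.2 ht
    (e := WithLp.toLp 2 (Pi.single m 1)) (by simp) (α := α)
    (by rw [re_inner_toEuclideanCLM hA.1]; simpa using hα) (WithLp.toLp 2 u)
  have hnorm : ‖WithLp.toLp 2 u‖ ^ 2 = ∑ i, normSq (u i) := by
    rw [EuclideanSpace.norm_sq_eq]; simp [normSq_eq_norm_sq]
  have hinner : (inner ℂ (WithLp.toLp 2 (Pi.single m (1 : ℂ))) (WithLp.toLp 2 u)).re =
      D.re / P.re := by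
    rw [EuclideanSpace.inner_toLp_toLp]
    have : u ⬝ᵥ star (Pi.single m (1 : ℂ)) = u m := by
      simp [dotProduct, Pi.single_apply]
    rw [this, hum, ofReal_re]
  rw [re_inner_toEuclideanCLM hA.1, hnorm, hinner] at hvar
  have hfin : D.re / P.re ≤ 1 / t + α / (t * (t - 1)) := by linarith
  rwa [div_le_iff₀ hP0] at hfin

end Resolvent

/-! ### The barrier argument. -/

section Barrier

open Complex ComplexConjugate Polynomial

theorem Multiset.exists_map_univ_eq {σ τ : Type*} [Fintype σ] (s : Multiset τ)
    (h : s.card = Fintype.card σ) : ∃ f : σ → τ, Finset.univ.val.map f = s := by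
  classical
  have e : σ ≃ s := Fintype.equivOfCardEq (by rw [Multiset.card_coe, h])
  refine ⟨fun i => (e i).1, ?_⟩
  have h1 := congrArg Finset.val (Finset.map_univ_equiv e)
  rw [Finset.map_val] at h1
  conv_rhs => rw [← Multiset.map_univ_coe s, ← h1, Multiset.map_map]
  rfl

theorem polarPart_prod_X_sub_C {σ : Type*} [Fintype σ] [DecidableEq σ] [Nonempty σ] (a : σ → ℂ) :
    polarPart (Fintype.card σ) (∏ j, (X - C (a j))) = ∑ j, (X - C (a j)) := by
  have := polarPart_prod_affine (fun _ => 1) (fun j => -a j)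
  simpa [sub_eq_add_neg] using this

theorem polarPart_prod_erase {σ : Type*} [Fintype σ] [DecidableEq σ] [Nonempty σ] (a : σ → ℂ)
    (i : σ) :
    polarPart (Fintype.card σ) (∏ j ∈ Finset.univ.erase i, (X - C (a j))) = 1 := by
  have h := polarPart_prod_affine (fun j => if j = i then 0 else 1)
    (fun j => if j = i then 1 else -a j)
  have h1 : ∏ j ∈ Finset.univ.erase i, (C (if j = i then (0 : ℂ) else 1) * X +
      C (if j = i then 1 else -a j)) = ∏ j ∈ Finset.univ.erase i, (X - C (a j)) :=
    Finset.prod_congr rfl fun j hj => by simp [Finset.ne_of_mem_erase hj, sub_eq_add_neg]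
  have h2 : ∏ j ∈ Finset.univ.erase i, (C (if j = i then (0 : ℂ) else 1)) = 1 :=
    Finset.prod_eq_one fun j hj => by simp [Finset.ne_of_mem_erase hj]
  rw [← Finset.mul_prod_erase Finset.univ _ (Finset.mem_univ i),
    Finset.sum_eq_single_of_mem i (Finset.mem_univ i), h1, h2] at h
  · simpa only [if_true, C_0, C_1, zero_mul, zero_add, one_mul] using h
  · intro j _ hji
    rw [Finset.prod_eq_zero (i := i) (Finset.mem_erase.mpr ⟨hji.symm, Finset.mem_univ i⟩), mul_zero]
    rw [if_pos rfl, C_0]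

/-- If the harmonic mean of positive numbers is large then so is each sum omitting one of them. -/
theorem le_sum_erase_of_sum_inv_le {σ : Type*} [Fintype σ] [DecidableEq σ] {u : σ → ℝ}
    (hu : ∀ i, 0 < u i) {c d : ℝ} (hc : 0 < c) (hsum : ∑ i, (u i)⁻¹ ≤ c)
    (hd : d * c ≤ ((Fintype.card σ : ℝ) - 1) ^ 2) (j : σ) :
    d ≤ ∑ i ∈ Finset.univ.erase j, u i := by
  -- Cauchy-Schwarz over the indices other than `j`; their number is the source of `(r - 1) ^ 2`.
  have hcs := Finset.sum_sq_le_sum_mul_sum_of_sq_le_mul (Finset.univ.erase j)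
    (r := fun _ => (1 : ℝ)) (f := u) (g := fun i => (u i)⁻¹)
    (fun i _ => (hu i).le) (fun i _ => (inv_pos.mpr (hu i)).le)
    (fun i _ => by rw [one_pow, mul_inv_cancel₀ (hu i).ne'])
  have hcard : ∑ _i ∈ Finset.univ.erase j, (1 : ℝ) = (Fintype.card σ : ℝ) - 1 := by
    rw [Finset.sum_const, Finset.card_erase_of_mem (Finset.mem_univ j), Finset.card_univ,
      nsmul_one, Nat.cast_pred (Fintype.card_pos_iff.mpr ⟨j⟩)]
  rw [hcard] at hcs
  have h1 : ∑ i ∈ Finset.univ.erase j, (u i)⁻¹ ≤ c := by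
    refine le_trans (Finset.sum_le_sum_of_subset_of_nonneg (Finset.erase_subset _ _) ?_) hsum
    exact fun i _ _ => (inv_pos.mpr (hu i)).le
  have h0 : 0 ≤ ∑ i ∈ Finset.univ.erase j, u i := Finset.sum_nonneg fun i _ => (hu i).le
  refine le_of_mul_le_mul_right ?_ hc
  calc d * c ≤ _ := hd
    _ ≤ _ := hcs
    _ ≤ _ := mul_le_mul_of_nonneg_left h1 h0

variable {ι κ : Type*} [Fintype ι] [DecidableEq ι] [Fintype κ] [DecidableEq κ]

theorem mixedDet_congr {R : Type*} [CommRing R] [Algebra ℂ R] (A : Matrix ι ι ℂ) (V : List ι)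
    {B : κ → Finset ι} {z w : κ → ι → R} (h : ∀ l, ∀ i ∈ B l, z l i = w l i) :
    mixedDet A V B z = mixedDet A V B w := by
  induction V generalizing B with
  | nil => exact Finset.prod_congr rfl fun l _ => principalDet_congr A _ (h l)
  | cons k V ih =>
    refine Finset.sum_congr rfl fun j _ => ih fun l i hi => h l i ?_
    unfold keepOnly at hi
    split_ifs at hi
    · exact hi
    · exact Finset.mem_of_mem_erase hi

/-- The value of a mixed determinant at a real point. -/
noncomputable def mixedRe (A : Matrix ι ι ℂ) (V : List ι) (B : κ → Finset ι) (x : ι → ℝ) : ℝ :=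
  (mixedDet A V B fun _ i => (x i : ℂ)).re

theorem ofReal_mixedRe {A : Matrix ι ι ℂ} (hA : A.IsHermitian) (V : List ι) (B : κ → Finset ι)
    (x : ι → ℝ) : (mixedRe A V B x : ℂ) = mixedDet A V B fun _ i => (x i : ℂ) :=
  Complex.ext rfl (by rw [ofReal_im]; exact (im_mixedDet_ofReal hA V B fun _ => x).symm)

theorem mixedRe_cons (A : Matrix ι ι ℂ) (k : ι) (V : List ι) (B : κ → Finset ι) (x : ι → ℝ) :
    mixedRe A (k :: V) B x = ∑ j, mixedRe A V (keepOnly B k j) x := by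
  simp only [mixedRe, mixedDet, re_sum]

theorem mixedDet_dropAll_update (A : Matrix ι ι ℂ) (V : List ι) (B : κ → Finset ι) (k : ι)
    (z : ι → ℂ) (w : ℂ) :
    mixedDet A V (dropAll B k) (fun _ => Function.update z k w) =
      mixedDet A V (dropAll B k) fun _ => z :=
  mixedDet_congr A V fun _ i hi => by simp [Finset.ne_of_mem_erase hi]

theorem mixedRe_dropAll_update (A : Matrix ι ι ℂ) (V : List ι) (B : κ → Finset ι) (k : ι)
    (x : ι → ℝ) (w : ℝ) :
    mixedRe A V (dropAll B k) (Function.update x k w) = mixedRe A V (dropAll B k) x :=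
  congrArg re (mixedDet_congr A V fun _ i hi => by simp [Finset.ne_of_mem_erase hi])

theorem eval_slice_ofReal {A : Matrix ι ι ℂ} (hA : A.IsHermitian) (V : List ι) (B : κ → Finset ι)
    (k : ι) (x : ι → ℝ) (y : ℝ) :
    (slice A V B k fun i => (x i : ℂ)).eval (y : ℂ) = mixedRe A V B (Function.update x k y) := by
  rw [eval_slice, ofReal_mixedRe hA]
  congr 1
  ext l i
  by_cases hi : i = k
  · subst hi; simp
  · simp [hi]

/-- Stability excludes roots in the upper half plane, conjugation symmetry those in the lower, and
`hpos` those from `t` on. -/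
theorem exists_real_roots_slice [Nonempty κ] {A : Matrix ι ι ℂ} (hA : A.IsHermitian) {V : List ι}
    (hV : V.Nodup) {B : κ → Finset ι} (hVB : ∀ v ∈ V, ∀ l, v ∈ B l) {k : ι} (hk : ∀ l, k ∈ B l)
    (hkV : k ∉ V) {x : ι → ℝ} {t : ℝ} (hlead : 0 < mixedRe A V (dropAll B k) x)
    (hpos : ∀ y, t ≤ y → 0 < mixedRe A V B (Function.update x k y)) :
    ∃ a : κ → ℝ, (∀ j, a j < t) ∧ (slice A V B k fun i => (x i : ℂ)) =
      C (mixedRe A V (dropAll B k) x : ℂ) * ∏ j, (X - C (a j : ℂ)) := by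
  set p := slice A V B k fun i => (x i : ℂ)
  have hcoeff : p.coeff (Fintype.card κ) = (mixedRe A V (dropAll B k) x : ℂ) := by
    rw [coeff_slice_card A hk hkV, ofReal_mixedRe hA]
  have hne : p.coeff (Fintype.card κ) ≠ 0 := by
    rw [hcoeff]; exact_mod_cast hlead.ne'
  have hdeg : p.natDegree = Fintype.card κ :=
    le_antisymm (natDegree_slice_le A hk hkV _) (le_natDegree_of_ne_zero hne)
  have hsplit : p.Splits := IsAlgClosed.splits p
  have hp0 : p ≠ 0 := fun h => hne (by simp [h])
  obtain ⟨μ, hμ⟩ := Multiset.exists_map_univ_eq (σ := κ) p.roots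
    (by rw [← hdeg, hsplit.natDegree_eq_card_roots])
  have hprod : p = C (mixedRe A V (dropAll B k) x : ℂ) * ∏ j, (X - C (μ j)) := by
    conv_lhs => rw [hsplit.eq_prod_roots]
    rw [leadingCoeff, hdeg, hcoeff, ← hμ, Multiset.map_map]
    rfl
  have hupper : ∀ y : ℂ, 0 < y.im → p.eval y ≠ 0 := by
    intro y hy h0
    rw [eval_slice] at h0
    have h1 := prod_im_mul_norm_mixedDet_dropAll_le hA hV hVB hk hkV
      (z := fun _ => Function.update (fun i => (x i : ℂ)) k y) (fun l i => by
        by_cases hi : i = k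
        · subst hi; simpa using hy.le
        · simp [hi])
    rw [h0, mixedDet_dropAll_update, ← ofReal_mixedRe hA] at h1
    simp only [Function.update_self, Finset.prod_const, norm_zero, norm_real, Real.norm_eq_abs,
      abs_of_pos hlead] at h1
    exact absurd h1 (not_le.mpr (mul_pos (pow_pos hy _) hlead))
  have hconj : ∀ y : ℂ, p.eval (conj y) = conj (p.eval y) := by
    intro y
    rw [eval_slice, eval_slice, ← mixedDet_conj hA]
    congr 1
    ext l i
    by_cases hi : i = k
    · subst hi; simp
    · simp [hi]
  have hroot : ∀ j, p.eval (μ j) = 0 := by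
    intro j
    rw [hprod, eval_mul, eval_prod, Finset.prod_eq_zero (Finset.mem_univ j) (by simp), mul_zero]
  have hreal : ∀ j, ((μ j).re : ℂ) = μ j := by
    intro j
    refine Complex.ext rfl ?_
    rw [ofReal_im]
    rcases lt_trichotomy (μ j).im 0 with h | h | h
    · refine absurd (hconj (μ j)) ?_
      rw [hroot, map_zero]
      exact hupper _ (by simpa using h)
    · exact h.symm
    · exact absurd (hroot j) (hupper _ h)
  refine ⟨fun j => (μ j).re, fun j => ?_, ?_⟩
  · by_contra! h
    have h1 := hpos _ h
    have h2 := eval_slice_ofReal hA V B k x (μ j).re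
    rw [hreal, hroot] at h2
    exact h1.ne (by exact_mod_cast h2)
  · simpa only [hreal] using hprod

theorem mixedRe_nil {A : Matrix ι ι ℂ} (hA : IsPSDContraction A) (B : κ → Finset ι) {x : ι → ℝ}
    (hx : ∀ i, 1 < x i) :
    mixedRe A [] B x = ∏ l, (principalDet A (B l) fun i => (x i : ℂ)).re := by
  have h : ∀ l, (principalDet A (B l) fun i => (x i : ℂ)) =
      ((principalDet A (B l) fun i => (x i : ℂ)).re : ℂ) := fun l =>
    Complex.ext rfl (by simpa using (Complex.lt_def.mp (principalDet_pos hA (B l) hx)).2.symm)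
  rw [mixedRe, mixedDet, Finset.prod_congr rfl fun l _ => h l, ← ofReal_prod, ofReal_re]

theorem mixedRe_nil_pos {A : Matrix ι ι ℂ} (hA : IsPSDContraction A) (B : κ → Finset ι)
    {x : ι → ℝ} (hx : ∀ i, 1 < x i) : 0 < mixedRe A [] B x := by
  rw [mixedRe_nil hA B hx]
  exact Finset.prod_pos fun l _ => (Complex.lt_def.mp (principalDet_pos hA (B l) hx)).1

theorem mixedRe_nil_dropAt_le {A : Matrix ι ι ℂ} (hA : IsPSDContraction A) {B : κ → Finset ι}
    {l : κ} {m : ι} (hm : m ∈ B l) {t α : ℝ} (ht : 1 < t) (hα : (A m m).re ≤ α) {x : ι → ℝ}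
    (hx : ∀ i, t ≤ x i) :
    mixedRe A [] (dropAt B l m) x ≤ (1 / t + α / (t * (t - 1))) * mixedRe A [] B x := by
  have hx1 : ∀ i, 1 < x i := fun i => ht.trans_le (hx i)
  rw [mixedRe_nil hA _ hx1, mixedRe_nil hA _ hx1,
    ← Finset.mul_prod_erase Finset.univ _ (Finset.mem_univ l),
    ← Finset.mul_prod_erase Finset.univ (fun l => (principalDet A (B l) fun i => (x i : ℂ)).re)
      (Finset.mem_univ l), ← mul_assoc,
    Finset.prod_congr (s₁ := Finset.univ.erase l) rfl fun j hj => by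
      rw [dropAt, Function.update_of_ne (Finset.ne_of_mem_erase hj)]]
  refine mul_le_mul_of_nonneg_right ?_ (Finset.prod_nonneg fun j _ =>
    (Complex.lt_def.mp (principalDet_pos hA (B j) hx1)).1.le)
  rw [dropAt, Function.update_self]
  exact principalDet_erase_le hA hm ht hα hx

/-- The barrier argument for one variable: `p` has real roots below `y`, the quotient `q / p` maps
the upper half plane to the closed lower half plane, and it is at most `φ` at `y`; then the quotient
of the polar parts is at most `φ` at `y - δ`. -/
theorem polarPart_barrier {σ : Type*} [Fintype σ] [DecidableEq σ] [Nonempty σ] {c e y δ φ : ℝ}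
    (hc : 0 < c) {a : σ → ℝ} (ha : ∀ i, a i < y)
    (hδ : ∀ j, (Fintype.card σ : ℝ) * δ ≤ ∑ i ∈ Finset.univ.erase j, (y - a i))
    {p q : ℂ[X]} (hp : p = C (c : ℂ) * ∏ j, (X - C (a j : ℂ)))
    (hqdeg : q.natDegree ≤ Fintype.card σ) (hqlead : q.coeff (Fintype.card σ) = ((e * c : ℝ) : ℂ))
    (him : ∀ w : ℂ, 0 < w.im → (q.eval w * conj (p.eval w)).im ≤ 0)
    (hqp : (q.eval (y : ℂ)).re ≤ φ * (p.eval (y : ℂ)).re) :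
    ((polarPart (Fintype.card σ) q).eval ((y - δ : ℝ) : ℂ)).re ≤
      φ * ((polarPart (Fintype.card σ) p).eval ((y - δ : ℝ) : ℂ)).re := by
  set P : ℂ[X] := ∏ j, (X - C (a j : ℂ))
  have hPeval : ∀ w, P.eval w = ∏ j, (w - a j) := fun w => by simp [P, eval_prod]
  have hPdeg : P.natDegree = Fintype.card σ := by
    simp [P, natDegree_prod_of_monic _ _ fun j _ => monic_X_sub_C (a j : ℂ)]
  have hPmonic : P.Monic := monic_prod_of_monic _ _ fun j _ => monic_X_sub_C (a j : ℂ)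
  have hPlead : P.coeff (Fintype.card σ) = 1 := by rw [← hPdeg]; exact hPmonic
  set d := e * c
  -- Subtracting `d * P` makes the quotient proper. Its value over `P` is the real constant `d`, so
  -- the sign condition is unaffected.
  obtain ⟨b, hb, hq⟩ := exists_partialFractions Finset.univ a (q - C (d : ℂ) * P)
    (by
      rw [Finset.card_univ, degree_lt_iff_coeff_zero]
      intro m hm
      rcases hm.eq_or_lt with rfl | hm
      · rw [coeff_sub, coeff_C_mul, hPlead, hqlead, mul_one, sub_self]
      · rw [coeff_sub, coeff_C_mul, coeff_eq_zero_of_natDegree_lt (hqdeg.trans_lt hm),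
          coeff_eq_zero_of_natDegree_lt (hPdeg ▸ hm), mul_zero, sub_zero])
    (by
      intro w hw
      have h1 := him w hw
      have h2 : q.eval w * conj (p.eval w) = (c : ℂ) * (q.eval w * conj (P.eval w)) := by
        rw [hp, eval_mul, eval_C, map_mul, conj_ofReal]; ring
      rw [h2, im_ofReal_mul] at h1
      have h3 := nonpos_of_mul_nonpos_right h1 hc
      rw [← hPeval, eval_sub, eval_mul, eval_C, sub_mul, sub_im, mul_assoc, mul_conj,
        ← ofReal_mul, ofReal_im, sub_zero]
      exact h3)
  have hu : ∀ i, 0 < y - a i := fun i => sub_pos.mpr (ha i)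
  set S : ℝ := ∑ i, (y - δ - a i)
  have hS : ∀ i, y - a i ≤ S := by
    intro i
    have h1 := hδ i
    have h2 := Finset.add_sum_erase Finset.univ (fun i => y - a i) (Finset.mem_univ i)
    have h3 : S = ∑ i, (y - a i) - Fintype.card σ * δ := by
      simp only [S, Finset.sum_sub_distrib, Finset.sum_const, Finset.card_univ, nsmul_eq_mul]
      ring
    linarith
  have hS0 : 0 < S := (hu (Classical.arbitrary σ)).trans_le (hS _)
  have hpp : (polarPart (Fintype.card σ) p).eval ((y - δ : ℝ) : ℂ) = ((c * S : ℝ) : ℂ) := by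
    rw [hp, ← smul_eq_C_mul, map_smul, polarPart_prod_X_sub_C, eval_smul, eval_finsetSum]
    simp [S]
  have hqq : (polarPart (Fintype.card σ) q).eval ((y - δ : ℝ) : ℂ) =
      ((d * S + ∑ i, b i : ℝ) : ℂ) := by
    rw [sub_eq_iff_eq_add.mp hq, map_add, map_sum, ← smul_eq_C_mul, map_smul,
      polarPart_prod_X_sub_C]
    simp only [← smul_eq_C_mul, map_smul, polarPart_prod_erase]
    rw [eval_add, eval_smul, eval_finsetSum, eval_finsetSum]
    simp [S, add_comm]
  rw [hpp, hqq, ofReal_re, ofReal_re]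
  have hprod : 0 < ∏ i, (y - a i) := Finset.prod_pos fun i _ => hu i
  have hpy : p.eval (y : ℂ) = ((c * ∏ i, (y - a i) : ℝ) : ℂ) := by
    rw [hp, eval_mul, eval_C, hPeval]; push_cast; rfl
  have hqy : q.eval (y : ℂ) =
      ((d * ∏ i, (y - a i) + (∑ i, b i / (y - a i)) * ∏ i, (y - a i) : ℝ) : ℂ) := by
    rw [sub_eq_iff_eq_add.mp hq, eval_add, eval_mul, eval_C, hPeval, eval_finsetSum]
    have : ∀ i, (C (b i : ℂ) * ∏ j ∈ Finset.univ.erase i, (X - C (a j : ℂ))).eval (y : ℂ) =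
        ((b i / (y - a i) * ∏ i, (y - a i) : ℝ) : ℂ) := by
      intro i
      rw [← Finset.mul_prod_erase Finset.univ (fun i => y - a i) (Finset.mem_univ i), ← mul_assoc,
        div_mul_cancel₀ _ (hu i).ne']
      simp [eval_prod]
    simp only [this]
    rw [Finset.sum_mul]
    push_cast
    ring
  rw [hpy, hqy, ofReal_re, ofReal_re, ← add_mul, ← mul_assoc] at hqp
  have h1 := le_of_mul_le_mul_right hqp hprod
  -- The quotient of polar parts at `y - δ` is `(d + ∑ b i / S) / c`, and `q / p` at `y` is `(d + ∑
  -- b i / (y - a i)) / c`. Hence `y - a i ≤ S` and `0 ≤ b i` suffice.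
  have h2 : ∑ i, b i ≤ S * ∑ i, b i / (y - a i) := by
    rw [Finset.mul_sum]
    refine Finset.sum_le_sum fun i _ => ?_
    rw [mul_div_assoc', le_div_iff₀ (hu i), mul_comm S]
    exact mul_le_mul_of_nonneg_left (hS i) (hb i (Finset.mem_univ i))
  nlinarith

/-- The barrier bound: moving all variables with index in `V` down by `δ` keeps the mixed
determinant positive and its logarithmic derivatives below `φ`. -/
theorem mixedRe_barrier [Nonempty κ] {A : Matrix ι ι ℂ} (hA : IsPSDContraction A) {t α δ φ : ℝ}
    (ht : 1 < t) (hα : ∀ i, (A i i).re ≤ α) (hφ : φ = 1 / t + α / (t * (t - 1))) (hφ0 : 0 < φ)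
    (hδ : (Fintype.card κ * δ) * (Fintype.card κ * φ) ≤ ((Fintype.card κ : ℝ) - 1) ^ 2)
    {V : List ι} (hV : V.Nodup) {B : κ → Finset ι} (hVB : ∀ v ∈ V, ∀ l, v ∈ B l) {x : ι → ℝ}
    (hx : ∀ i, (if i ∈ V then t - δ else t) ≤ x i) :
    0 < mixedRe A V B x ∧
      ∀ m ∉ V, ∀ l, m ∈ B l → mixedRe A V (dropAt B l m) x ≤ φ * mixedRe A V B x := by
  induction V generalizing B x with
  | nil =>
    have hx' : ∀ i, t ≤ x i := fun i => by simpa using hx i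
    refine ⟨mixedRe_nil_pos hA B fun i => ht.trans_le (hx' i), fun m _ l hm => ?_⟩
    rw [hφ]
    exact mixedRe_nil_dropAt_le hA hm ht (hα m) hx'
  | cons k V ih =>
    obtain ⟨hkV, hV⟩ := List.nodup_cons.mp hV
    have hne : ∀ v ∈ V, v ≠ k := fun v hv h => hkV (h ▸ hv)
    have hmem : ∀ v ∈ V, ∀ l, v ∈ B l := fun v hv => hVB v (List.mem_cons_of_mem _ hv)
    have hk : ∀ l, k ∈ B l := hVB k List.mem_cons_self
    have hH := hA.1.1
    have hup : ∀ Y, t ≤ Y → ∀ i, (if i ∈ V then t - δ else t) ≤ Function.update x k Y i := by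
      intro Y hY i
      by_cases hi : i = k
      · subst hi; simpa [hkV] using hY
      · simpa [hi] using hx i
    have hlead : 0 < mixedRe A V (dropAll B k) x := by
      rw [← mixedRe_dropAll_update A V B k x t]
      exact (ih hV (fun v hv l => mem_dropAll (hmem v hv l) (hne v hv)) (hup t le_rfl)).1
    obtain ⟨a, hat, hp⟩ := exists_real_roots_slice hH hV hmem hk hkV (t := t) hlead
      fun Y hY => (ih hV hmem (hup Y hY)).1
    -- The point before coordinate `k` is lowered: the induction hypothesis is used at `y`, the
    -- polar part at `y - δ = x k`.
    set y := x k + δ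
    have hy : t ≤ y := by
      have := hx k
      simp at this
      linarith
    have hyδ : y - δ = x k := by simp [y]
    have hay : ∀ j, a j < y := fun j => (hat j).trans_le hy
    have hu : ∀ i, 0 < y - a i := fun i => sub_pos.mpr (hay i)
    obtain ⟨hFpos, hFbar⟩ := ih hV hmem (hup y hy)
    have hN : (0 : ℝ) < Fintype.card κ := by exact_mod_cast Fintype.card_pos
    set c := mixedRe A V (dropAll B k) x
    have hpy : mixedRe A V B (Function.update x k y) = c * ∏ i, (y - a i) := by
      have h := eval_slice_ofReal hH V B k x y
      rw [hp, eval_mul, eval_C, eval_prod] at h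
      simp only [eval_sub, eval_X, eval_C] at h
      exact_mod_cast h.symm
    have hinv : ∑ i, (y - a i)⁻¹ ≤ Fintype.card κ * φ := by
      have hder := congrArg (eval (y : ℂ)) (derivative_slice A hk hkV fun i => (x i : ℂ))
      rw [hp, derivative_C_mul, derivative_prod_finset, eval_finsetSum, eval_mul, eval_C,
        eval_finsetSum] at hder
      have h1 : ∀ i, ((∏ j ∈ Finset.univ.erase i, (X - C (a j : ℂ))) *
          derivative (X - C (a i : ℂ))).eval (y : ℂ) =
          (((y - a i)⁻¹ * ∏ i, (y - a i) : ℝ) : ℂ) := by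
        intro i
        rw [← Finset.mul_prod_erase Finset.univ (fun i => y - a i) (Finset.mem_univ i),
          inv_mul_cancel_left₀ (hu i).ne']
        simp [eval_prod]
      simp only [h1, eval_slice_ofReal hH] at hder
      have h2 : c * ((∑ i, (y - a i)⁻¹) * ∏ i, (y - a i)) =
          ∑ l, mixedRe A V (dropAt B l k) (Function.update x k y) := by
        rw [Finset.sum_mul]
        exact_mod_cast hder
      have h3 : ∑ l, mixedRe A V (dropAt B l k) (Function.update x k y) ≤
          Fintype.card κ * (φ * mixedRe A V B (Function.update x k y)) := by
        refine (Finset.sum_le_card_nsmul _ _ _ fun l _ => hFbar k hkV l (hk l)).trans_eq ?_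
        rw [nsmul_eq_mul, Finset.card_univ]
      rw [← h2, hpy] at h3
      have h4 : 0 < c * ∏ i, (y - a i) := hpy ▸ hFpos
      refine le_of_mul_le_mul_right ?_ h4
      linarith
    have hgap := le_sum_erase_of_sum_inv_le hu (mul_pos hN hφ0) hinv hδ
    have hval : ∀ B' : κ → Finset ι, (∀ l, k ∈ B' l) →
        (polarPart (Fintype.card κ) (slice A V B' k fun i => (x i : ℂ))).eval
          ((y - δ : ℝ) : ℂ) = mixedRe A (k :: V) B' x := by
      intro B' hk'
      rw [polarPart_slice A hk' hkV, eval_slice_ofReal hH, hyδ, Function.update_eq_self]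
    have hpos : 0 < mixedRe A (k :: V) B x := by
      have h1 := hval B hk
      rw [hp, ← smul_eq_C_mul, map_smul, polarPart_prod_X_sub_C, eval_smul, eval_finsetSum] at h1
      simp only [eval_sub, eval_X, eval_C, smul_eq_mul] at h1
      have h2 : mixedRe A (k :: V) B x = c * ∑ i, (y - δ - a i) := by exact_mod_cast h1.symm
      rw [h2]
      refine mul_pos hlead ?_
      have h3 : ∑ i, (y - δ - a i) = ∑ i, (y - a i) - Fintype.card κ * δ := by
        simp only [Finset.sum_sub_distrib, Finset.sum_const, Finset.card_univ, nsmul_eq_mul]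
        ring
      obtain ⟨j⟩ := ‹Nonempty κ›
      have h4 := Finset.add_sum_erase Finset.univ (fun i => y - a i) (Finset.mem_univ j)
      have := hgap j
      have := hu j
      linarith
    refine ⟨hpos, fun m hm l hml => ?_⟩
    simp only [List.mem_cons, not_or] at hm
    have hk' : ∀ l', k ∈ dropAt B l m l' := fun l' => mem_dropAt (hk l') (Ne.symm hm.1)
    have key := polarPart_barrier (e := mixedRe A V (dropAll (dropAt B l m) k) x / c) (φ := φ)
      hlead hay hgap hp (natDegree_slice_le A hk' hkV fun i => (x i : ℂ))
      (by rw [coeff_slice_card A hk' hkV, div_mul_cancel₀ _ hlead.ne', ofReal_mixedRe hH])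
      (by
        intro w hw
        -- Only coordinate `k` is nonreal and `m ≠ k`, so the lower bound becomes `0`: derivative
        -- over polynomial maps the upper half plane to the closed lower one.
        have h := im_mixedDet_mul_conj hH hV hmem hml hm.2
          (z := fun _ => Function.update (fun i => (x i : ℂ)) k w) (fun l i => by
            by_cases hi : i = k
            · subst hi; simpa using hw.le
            · simp [hi])
        rw [Function.update_of_ne hm.1, ofReal_im, zero_mul] at h
        rw [eval_slice, eval_slice]
        simp only [mul_im, conj_re, conj_im] at h ⊢
        linarith)
      (by rw [eval_slice_ofReal hH, eval_slice_ofReal hH, ofReal_re, ofReal_re]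
          exact hFbar m hm.2 l hml)
    rwa [hval _ hk', hval _ hk, ofReal_re, ofReal_re] at key

end Barrier

/-! ### Interlacing, choice of the paving, and choice of parameters. -/

section Selection

open Complex ComplexConjugate Polynomial

/-- The function `ε ↦ Im (f conj d)(x + ε I)` vanishes at `0` and is nonnegative for `ε > 0`; the
Wronskian is its derivative at `0`. -/
theorem wronskian_nonneg_of_im_mul_conj_nonneg {f d : ℂ[X]}
    (hf : ∀ x : ℝ, (f.eval (x : ℂ)).im = 0) (hd : ∀ x : ℝ, (d.eval (x : ℂ)).im = 0)
    (h : ∀ w : ℂ, 0 < w.im → 0 ≤ (f.eval w * conj (d.eval w)).im) (x : ℝ) :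
    0 ≤ (f.derivative.eval (x : ℂ)).re * (d.eval (x : ℂ)).re -
      (f.eval (x : ℂ)).re * (d.derivative.eval (x : ℂ)).re := by
  have hder : ∀ g : ℂ[X], HasDerivAt (fun ε : ℝ => g.eval ((x : ℂ) + ε * I))
      (g.derivative.eval (x : ℂ) * I) 0 := by
    intro g
    have h1 : HasDerivAt (fun w : ℂ => (x : ℂ) + w * I) I ((0 : ℝ) : ℂ) := by
      simpa using ((hasDerivAt_id ((0 : ℝ) : ℂ)).mul_const I).const_add (x : ℂ)
    have h2 : HasDerivAt (fun w : ℂ => g.eval ((x : ℂ) + w * I))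
        (g.derivative.eval (x : ℂ) * I) ((0 : ℝ) : ℂ) := by
      have h3 := HasDerivAt.comp (h := fun w : ℂ => (x : ℂ) + w * I)
        ((0 : ℝ) : ℂ) (g.hasDerivAt ((x : ℂ) + ((0 : ℝ) : ℂ) * I)) h1
      simpa [Function.comp_def] using h3
    exact h2.comp_ofReal
  have h1 := (hder f).mul (hder d).star
  have h2 := imCLM.hasFDerivAt.comp_hasDerivAt (0 : ℝ) h1
  have h3 := h2.tendsto_slope_zero_right
  have h4 := ge_of_tendsto h3 (b := 0) (Filter.eventually_of_mem self_mem_nhdsWithin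
    fun ε (hε : 0 < ε) => by
      have h5 := h ((x : ℂ) + ε * I) (by simpa using hε)
      have h6 : (f.eval (x : ℂ) * conj (d.eval (x : ℂ))).im = 0 := by
        simp [mul_im, hf, hd]
      simp only [Function.comp_apply, imCLM_apply, Pi.mul_apply, zero_add, ofReal_zero, zero_mul,
        add_zero, smul_eq_mul]
      refine mul_nonneg (inv_nonneg.mpr hε.le) (sub_nonneg.mpr ?_)
      exact h6.le.trans h5)
  simp [mul_im, hf, hd] at h4
  linarith

theorem mul_le_mul_of_im_mul_conj_nonneg {f d : ℂ[X]}
    (hf : ∀ x : ℝ, (f.eval (x : ℂ)).im = 0) (hd : ∀ x : ℝ, (d.eval (x : ℂ)).im = 0)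
    (h : ∀ w : ℂ, 0 < w.im → 0 ≤ (f.eval w * conj (d.eval w)).im) {a b : ℝ} (hab : a ≤ b)
    (hpos : ∀ x ∈ Set.Icc a b, 0 < (d.eval (x : ℂ)).re) :
    (f.eval (a : ℂ)).re * (d.eval (b : ℂ)).re ≤ (f.eval (b : ℂ)).re * (d.eval (a : ℂ)).re := by
  have hder : ∀ x ∈ Set.Icc a b,
      HasDerivAt (fun x : ℝ => (f.eval (x : ℂ)).re / (d.eval (x : ℂ)).re)
      (((f.derivative.eval (x : ℂ)).re * (d.eval (x : ℂ)).re -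
        (f.eval (x : ℂ)).re * (d.derivative.eval (x : ℂ)).re) / (d.eval (x : ℂ)).re ^ 2) x :=
    fun x hx => (f.hasDerivAt (x : ℂ)).real_of_complex.div (d.hasDerivAt (x : ℂ)).real_of_complex
      (hpos x hx).ne'
  have hmono := monotoneOn_of_deriv_nonneg (convex_Icc a b)
    (fun x hx => (hder x hx).continuousAt.continuousWithinAt)
    (fun x hx => (hder x (interior_subset hx)).differentiableAt.differentiableWithinAt)
    (fun x hx => by
      rw [(hder x (interior_subset hx)).deriv]
      exact div_nonneg (wronskian_nonneg_of_im_mul_conj_nonneg hf hd h x) (sq_nonneg _))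
  have := hmono (Set.left_mem_Icc.mpr hab) (Set.right_mem_Icc.mpr hab) hab
  rwa [div_le_div_iff₀ (hpos a (Set.left_mem_Icc.mpr hab))
    (hpos b (Set.right_mem_Icc.mpr hab))] at this

/-- If `f / d` increases wherever `d` is positive and `f` is positive on a half line, then so is
`d`. -/
theorem pos_of_im_mul_conj_nonneg {f d : ℂ[X]}
    (hf : ∀ x : ℝ, (f.eval (x : ℂ)).im = 0) (hd : ∀ x : ℝ, (d.eval (x : ℂ)).im = 0)
    (h : ∀ w : ℂ, 0 < w.im → 0 ≤ (f.eval w * conj (d.eval w)).im) {ρ T : ℝ}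
    (hT : ∀ x : ℝ, T < x → 0 < (d.eval (x : ℂ)).re)
    (hpos : ∀ x : ℝ, ρ ≤ x → 0 < (f.eval (x : ℂ)).re) {x : ℝ} (hx : ρ ≤ x) :
    0 < (d.eval (x : ℂ)).re := by
  by_contra! hneg
  have hfc : Continuous fun x : ℝ => (f.eval (x : ℂ)).re := by fun_prop
  have hdc : Continuous fun x : ℝ => (d.eval (x : ℂ)).re := by fun_prop
  set S := {x : ℝ | ρ ≤ x ∧ (d.eval (x : ℂ)).re ≤ 0}
  have hSbdd : BddAbove S := ⟨T, fun y hy => by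
    by_contra! hlt
    exact absurd (hT y hlt) (not_lt.mpr hy.2)⟩
  have hSclosed : IsClosed S :=
    (isClosed_le continuous_const continuous_id).inter (isClosed_le hdc continuous_const)
  obtain ⟨hs1, hs2⟩ : sSup S ∈ S := hSclosed.csSup_mem ⟨x, hx, hneg⟩ hSbdd
  set s := sSup S
  have hright : ∀ y, s < y → 0 < (d.eval (y : ℂ)).re := by
    intro y hy
    by_contra! hle
    exact absurd (le_csSup hSbdd ⟨hs1.trans hy.le, hle⟩) (not_le.mpr hy)
  -- At the last point `s` with `d ≤ 0`, monotonicity in cross-multiplied form passes to the limit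
  -- `y → s` and gives `f s * d (s + 1) ≤ f (s + 1) * d s`, where the left side is positive and the
  -- right is not.
  have hlim := le_of_tendsto_of_tendsto (b := nhdsWithin s (Set.Ioi s))
    (((hfc.mul_const ((d.eval ((s + 1 : ℝ) : ℂ)).re)).tendsto s).mono_left nhdsWithin_le_nhds)
    (((hdc.const_mul ((f.eval ((s + 1 : ℝ) : ℂ)).re)).tendsto s).mono_left nhdsWithin_le_nhds)
    (Filter.eventually_of_mem (Ioo_mem_nhdsGT (lt_add_one s)) fun y hy =>
      mul_le_mul_of_im_mul_conj_nonneg hf hd h hy.2.le fun z hz => hright z (hy.1.trans_le hz.1))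
  have h1 := mul_pos (hpos s hs1) (hright (s + 1) (by linarith))
  have h2 := mul_nonpos_of_nonneg_of_nonpos (hpos (s + 1) (by linarith)).le hs2
  linarith

variable {ι κ : Type*} [Fintype ι] [DecidableEq ι] [Fintype κ] [DecidableEq κ]

theorem mixedRe_pos [Nonempty κ] {A : Matrix ι ι ℂ} (hA : IsPSDContraction A) (V : List ι)
    (B : κ → Finset ι) {x : ι → ℝ} (hx : ∀ i, 1 < x i) : 0 < mixedRe A V B x := by
  induction V generalizing B with
  | nil => exact mixedRe_nil_pos hA B hx
  | cons k V ih =>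
    rw [mixedRe_cons]
    exact Finset.sum_pos (fun j _ => ih _) Finset.univ_nonempty

theorem eval_mixedDet_X (A : Matrix ι ι ℂ) (V : List ι) (B : κ → Finset ι) (w : ℂ) :
    (mixedDet A V B fun _ _ => (X : ℂ[X])).eval w = mixedDet A V B fun _ _ => w := by
  have h := map_mixedDet (aeval w : ℂ[X] →ₐ[ℂ] ℂ) A V B (fun _ _ => X)
  rw [← coe_aeval_eq_eval, h]
  simp

/-- The interlacing argument: positivity of the mixed determinant on a half line passes to one of
its summands. -/
theorem exists_keepOnly_pos [Nonempty κ] {A : Matrix ι ι ℂ} (hA : IsPSDContraction A) {k : ι}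
    {V : List ι} (hV : (k :: V).Nodup) {B : κ → Finset ι} (hVB : ∀ v ∈ k :: V, ∀ l, v ∈ B l)
    {ρ : ℝ} (hρ : ∀ x, ρ ≤ x → 0 < mixedRe A (k :: V) B fun _ => x) :
    ∃ j, ∀ x, ρ ≤ x → 0 < mixedRe A V (keepOnly B k j) fun _ => x := by
  obtain ⟨hkV, hV⟩ := List.nodup_cons.mp hV
  set f : κ → ℂ[X] := fun j => mixedDet A V (keepOnly B k j) fun _ _ => X
  set d : ℂ[X] := mixedDet A V (dropAll B k) fun _ _ => X
  have hf : ∀ j (x : ℝ), ((f j).eval (x : ℂ)).im = 0 := fun j x => by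
    rw [eval_mixedDet_X]; exact im_mixedDet_ofReal hA.1.1 V _ fun _ _ => x
  have hd : ∀ x : ℝ, (d.eval (x : ℂ)).im = 0 := fun x => by
    rw [eval_mixedDet_X]; exact im_mixedDet_ofReal hA.1.1 V _ fun _ _ => x
  have him : ∀ j (w : ℂ), 0 < w.im → 0 ≤ ((f j).eval w * conj (d.eval w)).im := by
    intro j w hw
    have h := im_mixedDet_mul_conj hA.1.1 hV (B := keepOnly B k j)
      (fun v hv l => mem_keepOnly (hVB v (List.mem_cons_of_mem _ hv) l) fun h => hkV (h ▸ hv))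
      (mem_keepOnly_self (hVB k List.mem_cons_self j)) hkV (z := fun _ _ => w) fun _ _ => hw.le
    rw [dropAt_keepOnly_self] at h
    rw [eval_mixedDet_X, eval_mixedDet_X]
    exact (mul_nonneg hw.le (normSq_nonneg _)).trans h
  have hfx : ∀ j (x : ℝ), ((f j).eval (x : ℂ)).re = mixedRe A V (keepOnly B k j) fun _ => x :=
    fun j x => by rw [eval_mixedDet_X, mixedRe]
  have hsum : ∀ x : ℝ, ((∑ j, f j).eval (x : ℂ)).re = mixedRe A (k :: V) B fun _ => x := by
    intro x
    rw [mixedRe_cons, eval_finsetSum, re_sum]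
    exact Finset.sum_congr rfl fun j _ => hfx j x
  have hdpos : ∀ x, ρ ≤ x → 0 < (d.eval (x : ℂ)).re := fun x hx =>
    pos_of_im_mul_conj_nonneg (f := ∑ j, f j) (d := d) (T := 1)
      (fun x => by rw [eval_finsetSum, im_sum]; exact Finset.sum_eq_zero fun j _ => hf j x) hd
      (fun w hw => by
        rw [eval_finsetSum, Finset.sum_mul, im_sum]
        exact Finset.sum_nonneg fun j _ => him j w hw)
      (fun y hy => by rw [eval_mixedDet_X]; exact mixedRe_pos hA V _ fun _ => hy)
      (fun y hy => by rw [hsum]; exact hρ y hy) hx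
  obtain ⟨j, -, hj⟩ : ∃ j ∈ Finset.univ, 0 < mixedRe A V (keepOnly B k j) fun _ => ρ := by
    refine Finset.exists_lt_of_sum_lt (f := fun _ => (0 : ℝ)) ?_
    rw [Finset.sum_const_zero, ← mixedRe_cons]
    exact hρ ρ le_rfl
  refine ⟨j, fun x hx => ?_⟩
  have h1 := mul_le_mul_of_im_mul_conj_nonneg (hf j) hd (him j) hx fun y hy => hdpos y hy.1
  rw [hfx, hfx] at h1
  have h2 := (mul_pos hj (hdpos x hx)).trans_le h1
  exact pos_of_mul_pos_left h2 (hdpos ρ le_rfl).le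

theorem exists_family_pos [Nonempty κ] {A : Matrix ι ι ℂ} (hA : IsPSDContraction A)
    {V : List ι} (hV : V.Nodup) {B : κ → Finset ι} (hVB : ∀ v ∈ V, ∀ l, v ∈ B l)
    {ρ : ℝ} (hρ : ∀ x, ρ ≤ x → 0 < mixedRe A V B fun _ => x) :
    ∃ B' : κ → Finset ι, (∀ i ∉ V, ∀ l, i ∈ B' l ↔ i ∈ B l) ∧
      (∀ v ∈ V, ∃ j, ∀ l, v ∈ B' l ↔ l = j) ∧
      ∀ x, ρ ≤ x → 0 < mixedRe A [] B' fun _ => x := by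
  induction V generalizing B with
  | nil => exact ⟨B, fun _ _ _ => Iff.rfl, by simp, hρ⟩
  | cons k V ih =>
    obtain ⟨j, hj⟩ := exists_keepOnly_pos hA hV hVB hρ
    obtain ⟨hkV, hV⟩ := List.nodup_cons.mp hV
    obtain ⟨B', h1, h2, h3⟩ := ih hV (fun v hv l =>
      mem_keepOnly (hVB v (List.mem_cons_of_mem _ hv) l) fun h : v = k => hkV (h ▸ hv)) hj
    refine ⟨B', fun i hi l => ?_, fun v hv => ?_, h3⟩
    · simp only [List.mem_cons, not_or] at hi
      rw [h1 i hi.2 l, keepOnly]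
      split_ifs <;> simp [hi.1]
    · rcases List.mem_cons.mp hv with rfl | hv
      · refine ⟨j, fun l => ?_⟩
        rw [h1 v hkV l, keepOnly]
        split_ifs with hl <;> simp [hl, hVB v List.mem_cons_self]
      · exact h2 v hv

theorem principalDet_eq_zero_of_hasEigenvalue (A : Matrix ι ι ℂ) (S : Finset ι) {μ : ℂ}
    (h : Module.End.HasEigenvalue (Matrix.toLin' (principalBlock A S)) μ) :
    principalDet A S (fun _ => μ) = 0 := by
  obtain ⟨w, hw⟩ := h.exists_hasEigenvector
  have hw1 := hw.apply_eq_smul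
  obtain ⟨⟨i0, hi0⟩, hne⟩ := Function.ne_iff.mp hw.2
  refine Matrix.exists_mulVec_eq_zero_iff.mp
    ⟨fun i => if h : i ∈ S then w ⟨i, h⟩ else 0, fun h0 => hne ?_, ?_⟩
  · simpa [hi0] using congrFun h0 i0
  · ext i
    simp only [Matrix.mulVec, dotProduct, Pi.zero_apply]
    by_cases hi : i ∈ S
    · have h1 := congrFun hw1 ⟨i, hi⟩
      simp only [Matrix.toLin'_apply, Matrix.mulVec, dotProduct, principalBlock,
        Matrix.submatrix_apply, Pi.smul_apply, smul_eq_mul] at h1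
      have h2 : ∀ j, maskedMatrix A S (fun _ => μ) i j * (if h : j ∈ S then w ⟨j, h⟩ else 0) =
          (if i = j then μ * w ⟨i, hi⟩ else 0) -
            (if h : j ∈ S then A i j * w ⟨j, h⟩ else 0) := by
        intro j
        by_cases hj : j ∈ S
        · by_cases hij : i = j
          · subst hij; simp [maskedMatrix, hi, sub_mul]
          · simp [maskedMatrix, hi, hj, hij]
        · have : i ≠ j := fun h => hj (h ▸ hi)
          simp [hj, this]
      simp only [h2, Finset.sum_sub_distrib]
      rw [Finset.sum_ite_eq, if_pos (Finset.mem_univ i), ← h1, sub_eq_zero,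
        ← Finset.sum_subset (Finset.subset_univ S) (fun j _ hj => by simp [hj]),
        ← Finset.sum_coe_sort S]
      exact Finset.sum_congr rfl fun j _ => by simp
    · refine Finset.sum_eq_zero fun j _ => ?_
      by_cases hij : i = j
      · subst hij; simp [hi]
      · simp [maskedMatrix, hi, hij]

/-- With `s = t - 1`, the full shift `1 / φ = t * s / (s + α)` would leave at most `α + 1 / (4 * s)
= α + y ^ 2 / 2`. The factor `(1 - 1 / r) ^ 2` in `δ` costs at most `2 * y ^ 4 * t = 2 * y ^ 4 + y ^
2` more. Taking `s` of order `√r` keeps both errors of order `y ^ 2`; the claim then follows from `y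
≤ 1`. -/
theorem sub_shift_le {r y α t φ δ : ℝ} (hy : 0 < y) (hy1 : y ≤ 1) (hr : r * y ^ 4 = 1)
    (hα : 0 ≤ α) (ht : t = 1 + 1 / (2 * y ^ 2)) (hφ : φ = 1 / t + α / (t * (t - 1)))
    (hδ : δ = (r - 1) ^ 2 / (r ^ 2 * φ)) : t - δ ≤ 4 * y + α := by
  set s := 1 / (2 * y ^ 2)
  have hs : 0 < s := by positivity
  have ht0 : 0 < t := by rw [ht]; positivity
  have hts : t - 1 = s := by rw [ht]; ring
  have hr0 : r = 1 / y ^ 4 := by field_simp; exact hr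
  have hδ' : δ = (1 - y ^ 4) ^ 2 * (t * s / (s + α)) := by
    rw [hδ, hφ, hts, hr0]; field_simp
  have h1 : t * s / (s + α) ≤ t := by
    rw [div_le_iff₀ (by positivity)]; nlinarith
  have h0 : 0 ≤ t * s / (s + α) := by positivity
  have h2 : t - t * s / (s + α) ≤ α + 1 / (4 * s) := by
    have e : α + 1 / (4 * s) - (t - t * s / (s + α)) =
        (s * (1 - 2 * α) ^ 2 + α) / (4 * s * (s + α)) := by
      rw [ht]; field_simp; ring
    have : 0 ≤ (s * (1 - 2 * α) ^ 2 + α) / (4 * s * (s + α)) := by positivity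
    linarith
  have h3 : 1 / (4 * s) = y ^ 2 / 2 := by simp only [s]; field_simp; norm_num
  have h4 : y ^ 4 * t = y ^ 4 + y ^ 2 / 2 := by rw [ht]; simp only [s]; field_simp
  have hy2 : y ^ 2 ≤ y := by nlinarith
  have hy4 : y ^ 4 ≤ y := by nlinarith [sq_nonneg y]
  have h5 : (1 - 2 * y ^ 4) * (t * s / (s + α)) ≤ δ := by
    rw [hδ']
    refine mul_le_mul_of_nonneg_right ?_ h0
    nlinarith [sq_nonneg (y ^ 4)]
  have h6 : y ^ 4 * (t * s / (s + α)) ≤ y ^ 4 * t := by gcongr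
  nlinarith

end Selection

theorem mainTheorem4 (n r : ℕ) (hr : 1 ≤ r) (A : Matrix (Fin n) (Fin n) ℂ)
    (hA : IsPSDContraction A) (α : ℝ) (hα : ∀ i, (A i i).re ≤ α) :
    ∃ P : Paving (Fin n) r, ∀ j : Fin r, ∀ μ : ℝ,
      Module.End.HasEigenvalue (Matrix.toLin' (principalBlock A (P.block j))) (μ : ℂ) →
        μ ≤ 4 * (r : ℝ) ^ (-(1 / 4) : ℝ) + α := by
  have : Nonempty (Fin r) := ⟨⟨0, hr⟩⟩
  have hr0 : (0 : ℝ) < r := by exact_mod_cast hr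
  have hr1 : (1 : ℝ) ≤ r := by exact_mod_cast hr
  set y : ℝ := (r : ℝ) ^ (-(1 / 4) : ℝ)
  have hy : 0 < y := Real.rpow_pos_of_pos hr0 _
  have hy1 : y ≤ 1 := Real.rpow_le_one_of_one_le_of_nonpos hr1 (by norm_num)
  have hry : (r : ℝ) * y ^ 4 = 1 := by
    rw [← Real.rpow_natCast y, ← Real.rpow_mul hr0.le,
      show (-(1 / 4) : ℝ) * ((4 : ℕ) : ℝ) = -1 by norm_num, Real.rpow_neg_one,
      mul_inv_cancel₀ hr0.ne']
  -- For `n = 0` the number `α` may be negative, while the barrier needs a nonnegative bound.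
  set β := max α 0
  have hβ : ∀ i, (A i i).re ≤ β := fun i => (hα i).trans (le_max_left _ _)
  have hβ0 : 0 ≤ β := le_max_right _ _
  obtain ⟨t, ht⟩ : ∃ t : ℝ, t = 1 + 1 / (2 * y ^ 2) := ⟨_, rfl⟩
  have ht1 : 1 < t := by rw [ht]; exact lt_add_of_pos_right _ (by positivity)
  have hs0 : 0 < t - 1 := sub_pos.mpr ht1
  have ht0 : 0 < t := by linarith
  obtain ⟨φ, hφ⟩ : ∃ φ : ℝ, φ = 1 / t + β / (t * (t - 1)) := ⟨_, rfl⟩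
  have hφ0 : 0 < φ := by rw [hφ]; positivity
  obtain ⟨δ, hδ⟩ : ∃ δ : ℝ, δ = ((r : ℝ) - 1) ^ 2 / ((r : ℝ) ^ 2 * φ) := ⟨_, rfl⟩
  have hbound := sub_shift_le hy hy1 hry hβ0 ht hφ hδ
  have hpos : ∀ x, t - δ ≤ x → 0 < mixedRe A (Finset.univ : Finset (Fin n)).toList
      (fun _ : Fin r => Finset.univ) fun _ => x := fun x hx =>
    (mixedRe_barrier (δ := δ) hA ht1 hβ hφ hφ0
      (by rw [Fintype.card_fin, hδ]; apply le_of_eq; field_simp)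
      (Finset.nodup_toList _) (fun _ _ _ => Finset.mem_univ _) fun i => by simpa using hx).1
  obtain ⟨B, -, hB, hBpos⟩ := exists_family_pos hA (Finset.nodup_toList _)
    (fun _ _ _ => Finset.mem_univ _) hpos
  choose c hc using fun i => hB i (by simp)
  refine ⟨⟨B, fun j k hjk => Finset.disjoint_left.mpr fun i hij hik =>
    hjk (((hc i j).mp hij).trans ((hc i k).mp hik).symm), fun i => ⟨c i, (hc i _).mpr rfl⟩⟩,
    fun j μ hμ => ?_⟩
  have hdet := principalDet_eq_zero_of_hasEigenvalue A _ hμ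
  have hμt : μ < t - δ := by
    by_contra! hle
    refine (hBpos μ hle).ne' ?_
    rw [mixedRe, mixedDet, Finset.prod_eq_zero (Finset.mem_univ j) hdet, Complex.zero_re]
  -- An eigenvector provides an index, and a diagonal entry of `A` is nonnegative; hence `0 ≤ α` and
  -- `β = α`.
  obtain ⟨w, hw⟩ := hμ.exists_hasEigenvector
  obtain ⟨i, -⟩ := Function.ne_iff.mp hw.2
  have hα0 : 0 ≤ α :=
    (Complex.le_def.mp (hA.1.diag_nonneg (i := (i : Fin n)))).1.trans (hα i)
  rw [show β = α from max_eq_left hα0] at hbound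
  linarith
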